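/- **Definitions.** A *complex $*$-category* is a category whose Hom-sets are complex vector spaces with bilinear composition, equipped with a contravariant conjugate-linear involution $x\mapsto x^*$ acting identically on objects. *$*$-functors* are complex linear on the spaces of morphisms. A *fundamental symmetry* of a $*$-category $\mathcal C$ is a covariant $*$-functor $\alpha:\mathcal C\to\mathcal C$ that is the identity on objects, satisfies $\alpha\circ\alpha=\mathrm{id}$, and is such that (i) for some choice of norms making every $\mathrm{Hom}_{\mathcal C}(A,B)$ a Banach space, $\|\alpha(x^*)\circ x\|=\|x\|^2$ for every morphism $x$; and (ii) for every morphism $x:A\to B$ the element $p=\alpha(x^*)\circ x$ of $\mathrm{Hom}_{\mathcal C}(A,A)$ is positive for the involution $y\mapsto\alpha(y^*)$, i.e. $\alpha(p^*)=p$ and the spectrum of $p$ is contained in $[0,\infty)$. A *Kreĭn C\*-category* is a $*$-category that admits a fundamental symmetry. A *Kreĭn space* is a complex vector space $K$ with a Hermitian sesquilinear form $\langle\cdot,\cdot\rangle$ that admits a decomposition $K=K_+\oplus K_-$ into orthogonal subspaces such that $K_+$ is a Hilbert space for $\langle\cdot,\cdot\rangle$ and $K_-$ is a Hilbert space for $-\langle\cdot,\cdot\rangle$.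 The associated operator $J:x_++x_-\mapsto x_+-x_-$ is called a fundamental symmetry of $K$. The Hilbert norms $\|x\|_J=\langle x,Jx\rangle^{1/2}$ given by the various $J$ all induce the same topology on $K$, called the strong topology. For a family $\mathfrak K=(K_i)_i$ of Kreĭn spaces, $\mathcal B(\mathfrak K)$ is the $*$-category whose objects are the members of the family, whose morphisms are the strongly continuous linear maps $T:K_i\to K_j$, and whose involution is the Kreĭn adjoint, $\langle Tx,y\rangle=\langle x,T^*y\rangle$. For a family $J=(J_i)_i$ of fundamental symmetries put $\alpha_J(T):=J_j\,T\,J_i$ for $T:K_i\to K_j$. A $*$-subcategory of $\mathcal B(\mathfrak K)$ is *closed* if each of its spaces of morphisms is closed for the operator norm (for any choice of fundamental symmetries). **Theorem.** Let $\alpha$ be a fundamental symmetry of a Kreĭn C\*-category $\mathcal C$. Then there exist a family $\mathfrak K=(K_A)_{A\in\mathrm{Ob}\,\mathcal C}$ of Kreĭn spaces, a fundamental symmetry $J_A$ of each $K_A$, and a faithful representation of $\mathcal C$, i.e. a faithful (unital) covariant $*$-functor $\pi:\mathcal C\to\mathcal B(\mathfrak K)$ with $A\mapsto K_A$ on objects,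 such that 1. $\pi$ is $\alpha$-covariant: $\pi(\alpha(x))=\alpha_J(\pi(x))$ for every morphism $x$ of $\mathcal C$; 2. $\pi$ is an isomorphism of $\mathcal C$ onto a closed $*$-subcategory $\mathcal S$ of $\mathcal B(\mathfrak K)$ which is a Kreĭn C\*-category, the restriction of $\alpha_J$ to $\mathcal S$ being one of its fundamental symmetries. -/

import Mathlib

open CategoryTheory

universe u v w

noncomputable section

namespace Krein

/-! ### Complex star-categories and Krein C*-categories -/

/-- A complex star-category: a category enriched in complex vector spaces, with a contravariant
conjugate-linear involution on morphisms that is the identity on objects. -/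
class StarCategory (C : Type u) [Category.{v} C] [Preadditive C] [Linear ℂ C] where
  /-- the involution `x ↦ x*` -/
  star : ∀ {X Y : C}, (X ⟶ Y) → (Y ⟶ X)
  star_star : ∀ {X Y : C} (x : X ⟶ Y), star (star x) = x
  star_add : ∀ {X Y : C} (x y : X ⟶ Y), star (x + y) = star x + star y
  star_smul : ∀ {X Y : C} (c : ℂ) (x : X ⟶ Y), star (c • x) = (starRingEnd ℂ c) • star x
  star_comp : ∀ {X Y Z : C} (x : X ⟶ Y) (y : Y ⟶ Z), star (x ≫ y) = star y ≫ star x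

open StarCategory (star)

/-- A (complex linear, unital) covariant star-functor. -/
structure IsStarFunctor {C : Type*} {D : Type*} [Category* C] [Preadditive C] [Linear ℂ C]
    [StarCategory C] [Category* D] [Preadditive D] [Linear ℂ D] [StarCategory D]
    (F : C ⥤ D) : Prop where
  map_add : ∀ {X Y : C} (x y : X ⟶ Y), F.map (x + y) = F.map x + F.map y
  map_smul : ∀ {X Y : C} (c : ℂ) (x : X ⟶ Y), F.map (c • x) = c • F.map x
  map_star : ∀ {X Y : C} (x : X ⟶ Y), F.map (star x) = star (F.map x)

/-- An isomorphism of star-categories: a star-functor that is bijective on objects and on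
morphisms. -/
structure IsStarIso {C : Type*} {D : Type*} [Category* C] [Preadditive C] [Linear ℂ C]
    [StarCategory C] [Category* D] [Preadditive D] [Linear ℂ D] [StarCategory D]
    (F : C ⥤ D) : Prop extends IsStarFunctor F where
  bijective_obj : Function.Bijective F.obj
  bijective_map : ∀ X Y : C, Function.Bijective (F.map : (X ⟶ Y) → (F.obj X ⟶ F.obj Y))

/-- A covariant star-functor `α : C → C` with `α ∘ α = id` which is the identity on objects. -/
structure Involution (C : Type u) [Category.{v} C] [Preadditive C] [Linear ℂ C]
    [StarCategory C] where
  map : ∀ {X Y : C}, (X ⟶ Y) →ₗ[ℂ] (X ⟶ Y)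
  map_id : ∀ X : C, map (𝟙 X) = 𝟙 X
  map_comp : ∀ {X Y Z : C} (x : X ⟶ Y) (y : Y ⟶ Z), map (x ≫ y) = map x ≫ map y
  map_star : ∀ {X Y : C} (x : X ⟶ Y), map (star x) = star (map x)
  map_map : ∀ {X Y : C} (x : X ⟶ Y), map (map x) = x

/-- A seminorm that is a norm for which the space is complete. -/
structure IsBanachNorm {V : Type*} [AddCommGroup V] [Module ℂ V] (N : Seminorm ℂ V) : Prop where
  eq_zero : ∀ x, N x = 0 → x = 0
  complete : ∀ s : ℕ → V,
    (∀ ε > 0, ∃ n₀, ∀ m ≥ n₀, ∀ n ≥ n₀, N (s m - s n) < ε) →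
      ∃ x, Filter.Tendsto (fun n => N (s n - x)) Filter.atTop (nhds 0)

namespace Involution

variable {C : Type u} [Category.{v} C] [Preadditive C] [Linear ℂ C] [StarCategory C]

/-- Positivity of `p` in the algebra `Hom(X, X)` with involution `x ↦ α(x*)`: `p` is Hermitian
and its spectrum is contained in `[0, ∞)`. -/
def IsPositive (α : Involution C) {X : C} (p : X ⟶ X) : Prop :=
  α.map (star p) = p ∧ ∀ μ ∈ spectrum ℂ (A := End X) p, 0 ≤ μ.re ∧ μ.im = 0

/-- `α` is a fundamental symmetry: for some family of Banach norms on the spaces of morphisms,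
`‖α(x*) x‖ = ‖x‖²`, and every `α(x*) x` is positive.
(`x ≫ y` is the composition `y ∘ x`.) -/
def IsFundamentalSymmetry (α : Involution C) : Prop :=
  (∃ N : ∀ X Y : C, Seminorm ℂ (X ⟶ Y),
    (∀ X Y, IsBanachNorm (N X Y)) ∧
    ∀ {X Y : C} (x : X ⟶ Y), N X X (x ≫ α.map (star x)) = N X Y x ^ 2) ∧
  ∀ {X Y : C} (x : X ⟶ Y), α.IsPositive (x ≫ α.map (star x))

end Involution

/-- A Krein C*-category is a star-category that admits a fundamental symmetry. -/
class IsKreinCStarCategory (C : Type u) [Category.{v} C] [Preadditive C] [Linear ℂ C]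
    [StarCategory C] : Prop where
  exists_fundamentalSymmetry : ∃ α : Involution C, α.IsFundamentalSymmetry

/-! ### Star-subcategories -/

/-- A star-subcategory (with all the objects of the ambient category). -/
structure StarSubcategory (D : Type u) [Category.{v} D] [Preadditive D] [Linear ℂ D]
    [StarCategory D] where
  hom : ∀ X Y : D, Submodule ℂ (X ⟶ Y)
  id_mem : ∀ X : D, 𝟙 X ∈ hom X X
  comp_mem : ∀ {X Y Z : D} {x : X ⟶ Y} {y : Y ⟶ Z},
    x ∈ hom X Y → y ∈ hom Y Z → x ≫ y ∈ hom X Z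
  star_mem : ∀ {X Y : D} {x : X ⟶ Y}, x ∈ hom X Y → star x ∈ hom Y X

namespace StarSubcategory

variable {D : Type u} [Category.{v} D] [Preadditive D] [Linear ℂ D] [StarCategory D]

/-- The objects of a star-subcategory, regarded as a category on its own. -/
@[ext] structure Obj (S : StarSubcategory D) : Type u where
  obj : D

variable (S : StarSubcategory D)

instance : Category.{v} S.Obj where
  Hom X Y := S.hom X.obj Y.obj
  id X := ⟨𝟙 X.obj, S.id_mem X.obj⟩
  comp x y := ⟨x.1 ≫ y.1, S.comp_mem x.2 y.2⟩
  id_comp x := Subtype.ext (Category.id_comp x.1)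
  comp_id x := Subtype.ext (Category.comp_id x.1)
  assoc x y z := Subtype.ext (Category.assoc x.1 y.1 z.1)

instance : Preadditive S.Obj where
  homGroup X Y := inferInstanceAs (AddCommGroup (S.hom X.obj Y.obj))
  add_comp _ _ _ x y z := Subtype.ext (Preadditive.add_comp _ _ _ x.1 y.1 z.1)
  comp_add _ _ _ x y z := Subtype.ext (Preadditive.comp_add _ _ _ x.1 y.1 z.1)

instance : Linear ℂ S.Obj where
  homModule X Y := inferInstanceAs (Module ℂ (S.hom X.obj Y.obj))
  smul_comp _ _ _ c x y := Subtype.ext (Linear.smul_comp _ _ _ c x.1 y.1)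
  comp_smul _ _ _ x c y := Subtype.ext (Linear.comp_smul _ _ _ x.1 c y.1)

instance : StarCategory S.Obj where
  star x := ⟨star x.1, S.star_mem x.2⟩
  star_star x := Subtype.ext (StarCategory.star_star x.1)
  star_add x y := Subtype.ext (StarCategory.star_add x.1 y.1)
  star_smul c x := Subtype.ext (StarCategory.star_smul c x.1)
  star_comp x y := Subtype.ext (StarCategory.star_comp x.1 y.1)

/-- The inclusion functor of a star-subcategory. -/
def incl : S.Obj ⥤ D where
  obj X := X.obj
  map x := x.1
  map_id _ := rfl
  map_comp _ _ := rfl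

end StarSubcategory

/-! ### Krein spaces -/

/-- A Hermitian form restricted to the subspace `S` makes `S` a Hilbert space: it is positive
definite on `S`, and `S` is complete for `‖x‖² = ⟨x, x⟩`. -/
structure IsHilbertOn {V : Type*} [AddCommGroup V] [Module ℂ V] (B : V →ₗ⋆[ℂ] V →ₗ[ℂ] ℂ)
    (S : Submodule ℂ V) : Prop where
  pos : ∀ x ∈ S, x ≠ 0 → 0 < (B x x).re
  complete : ∀ s : ℕ → V, (∀ n, s n ∈ S) →
    (∀ ε > 0, ∃ n₀, ∀ m ≥ n₀, ∀ n ≥ n₀, (B (s m - s n) (s m - s n)).re < ε) →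
      ∃ x ∈ S, Filter.Tendsto (fun n => (B (s n - x) (s n - x)).re) Filter.atTop (nhds 0)

/-- `V = P ⊕ M`, with `P` and `M` orthogonal, `P` a Hilbert space for the form `B` and
`M` a Hilbert space for `-B`. -/
structure IsFundamentalDecomposition {V : Type*} [AddCommGroup V] [Module ℂ V]
    (B : V →ₗ⋆[ℂ] V →ₗ[ℂ] ℂ) (P M : Submodule ℂ V) : Prop where
  isCompl : IsCompl P M
  orthogonal : ∀ x ∈ P, ∀ y ∈ M, B x y = 0
  hilbert_pos : IsHilbertOn B P
  hilbert_neg : IsHilbertOn (-B) M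

/-- A complex Krein space; the form is conjugate-linear in the first variable and linear in the
second. -/
structure KreinSpace : Type (w + 1) where
  carrier : Type w
  [addCommGroup : AddCommGroup carrier]
  [module : Module ℂ carrier]
  form : carrier →ₗ⋆[ℂ] carrier →ₗ[ℂ] ℂ
  form_symm : ∀ x y, starRingEnd ℂ (form x y) = form y x
  exists_decomposition : ∃ P M : Submodule ℂ carrier, IsFundamentalDecomposition form P M

namespace KreinSpace

instance : CoeSort KreinSpace.{w} (Type w) := ⟨carrier⟩

attribute [instance] addCommGroup module

/-- The fundamental symmetries `x₊ + x₋ ↦ x₊ - x₋` of a Krein space. -/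
structure FundamentalSymmetry (K : KreinSpace.{w}) where
  toLin : K →ₗ[ℂ] K
  exists_decomposition : ∃ P M : Submodule ℂ K, IsFundamentalDecomposition K.form P M ∧
    ∀ x ∈ P, ∀ y ∈ M, toLin (x + y) = x - y

variable (K : KreinSpace.{w})

instance : Nonempty K.FundamentalSymmetry := by
  obtain ⟨P, M, h⟩ := K.exists_decomposition
  refine ⟨⟨P.subtype ∘ₗ P.projectionOnto M h.isCompl - M.subtype ∘ₗ M.projectionOnto P h.isCompl.symm,
    P, M, h, fun x hx y hy => ?_⟩⟩
  have h1 : P.projectionOnto M h.isCompl x = ⟨x, hx⟩ :=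
    Submodule.projectionOnto_apply_left h.isCompl ⟨x, hx⟩
  have h2 := (Submodule.projectionOnto_apply_eq_zero_iff h.isCompl (x := y)).2 hy
  have h3 : M.projectionOnto P h.isCompl.symm y = ⟨y, hy⟩ :=
    Submodule.projectionOnto_apply_left h.isCompl.symm ⟨y, hy⟩
  have h4 := (Submodule.projectionOnto_apply_eq_zero_iff h.isCompl.symm (x := x)).2 hx
  change ((P.projectionOnto M h.isCompl (x + y) : P) : K) -
    ((M.projectionOnto P h.isCompl.symm (x + y) : M) : K) = x - y
  rw [map_add, map_add, h1, h2, h3, h4, add_zero, zero_add]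

variable {K}

namespace FundamentalSymmetry

variable (J : K.FundamentalSymmetry)

instance : CoeFun K.FundamentalSymmetry (fun _ => K → K) := ⟨fun J => J.toLin⟩

theorem exists_parts : ∃ P M : Submodule ℂ K, IsFundamentalDecomposition K.form P M ∧
    (∀ x ∈ P, J x = x) ∧ (∀ x ∈ M, J x = -x) ∧
    ∀ x : K, ∃ p ∈ P, ∃ m ∈ M, x = p + m := by
  obtain ⟨P, M, h, hJ⟩ := J.exists_decomposition
  refine ⟨P, M, h, fun x hx => by simpa using hJ x hx 0 M.zero_mem,
    fun x hx => by simpa using hJ 0 P.zero_mem x hx, fun x => ?_⟩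
  obtain ⟨p, hp, m, hm, rfl⟩ := Submodule.mem_sup.1
    (h.isCompl.sup_eq_top ▸ Submodule.mem_top : x ∈ P ⊔ M)
  exact ⟨p, hp, m, hm, rfl⟩

theorem apply_apply (x : K) : J (J x) = x := by
  obtain ⟨P, M, h, hP, hM, hx⟩ := J.exists_parts
  obtain ⟨p, hp, m, hm, rfl⟩ := hx x
  simp [map_add, hP p hp, hM m hm]

theorem form_apply_right {P M : Submodule ℂ K} (h : IsFundamentalDecomposition K.form P M)
    (hP : ∀ x ∈ P, J x = x) (hM : ∀ x ∈ M, J x = -x) {p q m n : K}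
    (hp : p ∈ P) (hq : q ∈ P) (hm : m ∈ M) (hn : n ∈ M) :
    K.form (p + m) (J (q + n)) = K.form p q - K.form m n := by
  have h2 : K.form m q = 0 := by
    rw [← K.form_symm, h.orthogonal q hq m hm, map_zero]
  simp [map_add, hP q hq, hM n hn, h.orthogonal p hp n hn, h2, sub_eq_add_neg]

theorem form_symm_apply (x y : K) : K.form (J x) y = K.form x (J y) := by
  obtain ⟨P, M, h, hP, hM, hx⟩ := J.exists_parts
  obtain ⟨p, hp, m, hm, rfl⟩ := hx x
  obtain ⟨q, hq, n, hn, rfl⟩ := hx y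
  have := J.form_apply_right h hP hM hp hq (M.neg_mem hm) (M.neg_mem hn)
  rw [J.form_apply_right h hP hM hp hq hm hn]
  have h2 : K.form m q = 0 := by
    rw [← K.form_symm, h.orthogonal q hq m hm, map_zero]
  simp [map_add, hP p hp, hM m hm, h.orthogonal p hp n hn, h2, sub_eq_add_neg]

theorem form_self (x : K) (P M : Submodule ℂ K) (h : IsFundamentalDecomposition K.form P M) :
    (x ∈ P → x ≠ 0 → 0 < (K.form x x).re) ∧ (x ∈ M → x ≠ 0 → (K.form x x).re < 0) :=
  ⟨h.hilbert_pos.pos x, fun hx hx0 => by simpa using h.hilbert_neg.pos x hx hx0⟩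

/-- The inner product `⟨x, J y⟩ = ⟨x₊, y₊⟩ - ⟨x₋, y₋⟩` of `|K|_J = K₊ ⊕ (-K₋)`. -/
@[reducible] def core : InnerProductSpace.Core ℂ K where
  inner x y := K.form x (J y)
  conj_inner_symm x y := by rw [K.form_symm, form_symm_apply]
  re_inner_nonneg x := by
    obtain ⟨P, M, h, hP, hM, hx⟩ := J.exists_parts
    obtain ⟨p, hp, m, hm, rfl⟩ := hx x
    rw [J.form_apply_right h hP hM hp hp hm hm]
    have h1 : 0 ≤ (K.form p p).re := by
      rcases eq_or_ne p 0 with rfl | h0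
      · simp
      · exact ((form_self p P M h).1 hp h0).le
    have h2 : (K.form m m).re ≤ 0 := by
      rcases eq_or_ne m 0 with rfl | h0
      · simp
      · exact ((form_self m P M h).2 hm h0).le
    simp only [RCLike.re_to_complex, Complex.sub_re]
    linarith
  add_left x y z := by simp
  smul_left x y r := by simp
  definite x hx := by
    obtain ⟨P, M, h, hP, hM, hx'⟩ := J.exists_parts
    obtain ⟨p, hp, m, hm, rfl⟩ := hx' x
    change K.form (p + m) (J (p + m)) = 0 at hx
    rw [J.form_apply_right h hP hM hp hp hm hm] at hx
    have hre := congrArg Complex.re hx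
    simp only [Complex.sub_re, Complex.zero_re] at hre
    by_cases hp0 : p = 0
    · subst hp0
      by_cases hm0 : m = 0
      · simp [hm0]
      · have := (form_self m P M h).2 hm hm0
        simp at hre; linarith
    · have h1 := (form_self p P M h).1 hp hp0
      by_cases hm0 : m = 0
      · subst hm0; simp at hre; linarith
      · have := (form_self m P M h).2 hm hm0
        linarith

/-- The Hilbert space `|K|_J` associated to a fundamental symmetry `J`. -/
@[nolint unusedArguments]
def Assoc (_J : K.FundamentalSymmetry) : Type w := K

instance : NormedAddCommGroup J.Assoc :=
  @InnerProductSpace.Core.toNormedAddCommGroup ℂ K _ _ _ J.core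

instance : InnerProductSpace ℂ J.Assoc :=
  @InnerProductSpace.ofCore ℂ K _ _ _ J.core.toCore

instance : Inner ℂ J.Assoc := InnerProductSpace.toInner

/-- The identity map `K → |K|_J`. -/
def toAssoc : K ≃ₗ[ℂ] J.Assoc := LinearEquiv.refl ℂ K

theorem inner_toAssoc (x y : K) : inner ℂ (J.toAssoc x) (J.toAssoc y) = K.form x (J y) := rfl

theorem norm_sq_toAssoc (x : K) : ‖J.toAssoc x‖ ^ 2 = (K.form x (J x)).re := by
  rw [norm_sq_eq_re_inner (𝕜 := ℂ), inner_toAssoc]; rfl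

instance : CompleteSpace J.Assoc := by
  obtain ⟨P, M, h, hP, hM, hx⟩ := J.exists_parts
  refine Metric.complete_of_cauchySeq_tendsto fun s hs => ?_
  choose p hp m hm hpm using fun n => hx (J.toAssoc.symm (s n))
  have key : ∀ p ∈ P, ∀ m ∈ M, ‖J.toAssoc (p + m)‖ ^ 2 =
      (K.form p p).re + ((-K.form) m m).re := fun p hp m hm => by
    rw [norm_sq_toAssoc, J.form_apply_right h hP hM hp hp hm hm]
    simp [sub_eq_add_neg]
  have nnP : ∀ p ∈ P, 0 ≤ (K.form p p).re := fun p hp => by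
    rcases eq_or_ne p 0 with rfl | h0
    · simp
    · exact (h.hilbert_pos.pos p hp h0).le
  have nnM : ∀ p ∈ M, 0 ≤ ((-K.form) p p).re := fun p hp => by
    rcases eq_or_ne p 0 with rfl | h0
    · simp
    · exact (h.hilbert_neg.pos p hp h0).le
  have hsn : ∀ n, s n = J.toAssoc (p n + m n) := fun n => by
    rw [← hpm n, LinearEquiv.apply_symm_apply]
  have hdiff : ∀ a b, ‖s a - s b‖ ^ 2 =
      (K.form (p a - p b) (p a - p b)).re + ((-K.form) (m a - m b) (m a - m b)).re :=
    fun a b => by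
      rw [← key _ (P.sub_mem (hp a) (hp b)) _ (M.sub_mem (hm a) (hm b)), hsn, hsn, ← map_sub]
      congr 3; abel
  have cau : ∀ ε > 0, ∃ n₀, ∀ a ≥ n₀, ∀ b ≥ n₀, ‖s a - s b‖ ^ 2 < ε := fun ε hε => by
    obtain ⟨n₀, h₀⟩ := Metric.cauchySeq_iff.1 hs (Real.sqrt ε) (Real.sqrt_pos.2 hε)
    refine ⟨n₀, fun a ha b hb => ?_⟩
    have := h₀ a ha b hb
    rw [dist_eq_norm] at this
    exact (Real.lt_sqrt (norm_nonneg _)).1 this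
  obtain ⟨x, hxP, hx1⟩ := h.hilbert_pos.complete p hp fun ε hε => by
    obtain ⟨n₀, h₀⟩ := cau ε hε
    refine ⟨n₀, fun a ha b hb => ?_⟩
    have := h₀ a ha b hb
    have := nnM _ (M.sub_mem (hm a) (hm b))
    linarith [hdiff a b]
  obtain ⟨y, hyM, hy1⟩ := h.hilbert_neg.complete m hm fun ε hε => by
    obtain ⟨n₀, h₀⟩ := cau ε hε
    refine ⟨n₀, fun a ha b hb => ?_⟩
    have := h₀ a ha b hb
    have := nnP _ (P.sub_mem (hp a) (hp b))
    linarith [hdiff a b]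
  refine ⟨J.toAssoc (x + y), ?_⟩
  rw [tendsto_iff_norm_sub_tendsto_zero]
  have h2 : Filter.Tendsto (fun n => ‖s n - J.toAssoc (x + y)‖ ^ 2) Filter.atTop (nhds 0) := by
    have := hx1.add hy1
    rw [add_zero] at this
    refine this.congr fun n => ?_
    rw [← key _ (P.sub_mem (hp n) hxP) _ (M.sub_mem (hm n) hyM), hsn, ← map_sub]
    congr 3; abel
  have h3 := h2.sqrt
  simpa only [Real.sqrt_sq (norm_nonneg _), Real.sqrt_zero] using h3

theorem continuous_form_left (z : K) :
    Continuous fun x : J.Assoc => K.form (J.toAssoc.symm x) z := by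
  have : (fun x : J.Assoc => K.form (J.toAssoc.symm x) z) =
      fun x => inner ℂ x (J.toAssoc (J z)) := by
    funext x
    obtain ⟨x, rfl⟩ := J.toAssoc.surjective x
    rw [inner_toAssoc, apply_apply, LinearEquiv.symm_apply_apply]
  rw [this]
  fun_prop

theorem eq_of_form_left {x y : K} (h : ∀ z, K.form x z = K.form y z) : x = y := by
  obtain ⟨J⟩ := (inferInstance : Nonempty K.FundamentalSymmetry)
  rw [← sub_eq_zero]
  apply J.core.definite
  change K.form (x - y) (J (x - y)) = 0
  simp [h]

/-- The identity map `|K|_J → |K|_J'` is continuous. -/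
theorem continuous_change (J J' : K.FundamentalSymmetry) :
    Continuous (J.toAssoc.symm ≪≫ₗ J'.toAssoc) := by
  refine LinearMap.continuous_of_seq_closed_graph
    (g := (J.toAssoc.symm ≪≫ₗ J'.toAssoc : J.Assoc →ₗ[ℂ] J'.Assoc)) fun s x y hs hy => ?_
  apply J'.toAssoc.symm.injective
  refine eq_of_form_left fun z => ?_
  have h1 := ((J.continuous_form_left z).tendsto x).comp hs
  have h2 := ((J'.continuous_form_left z).tendsto y).comp hy
  refine tendsto_nhds_unique h2 (h1.congr fun n => ?_) |>.trans ?_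
  · rfl
  · rfl

end FundamentalSymmetry

/-- The strong topology of a Krein space: the topology generated by the norms of the associated
Hilbert spaces `|K|_J`. All these norms induce this same topology, see `strongTopology_eq`. -/
instance strongTopology (K : KreinSpace.{w}) : TopologicalSpace K :=
  ⨅ J : K.FundamentalSymmetry, TopologicalSpace.induced J.toAssoc inferInstance

theorem strongTopology_eq (J : K.FundamentalSymmetry) :
    strongTopology K = TopologicalSpace.induced J.toAssoc inferInstance := by
  refine le_antisymm (iInf_le _ J) (le_iInf fun J' => ?_)
  have := FundamentalSymmetry.continuous_change J J'
  rw [continuous_iff_le_induced] at this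
  have := induced_mono (g := J.toAssoc) this
  rw [induced_compose] at this
  exact this

/-- The identity map as a homeomorphism from `K` onto `|K|_J`. -/
def FundamentalSymmetry.toAssocL (J : K.FundamentalSymmetry) : K ≃L[ℂ] J.Assoc where
  toLinearEquiv := J.toAssoc
  continuous_toFun := by
    rw [continuous_iff_le_induced, strongTopology_eq J]; exact le_rfl
  continuous_invFun := by
    rw [strongTopology_eq J, continuous_induced_rng]
    exact continuous_id

instance (K : KreinSpace.{w}) : IsTopologicalAddGroup K := by
  obtain ⟨J⟩ := (inferInstance : Nonempty K.FundamentalSymmetry)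
  rw [strongTopology_eq J]
  exact topologicalAddGroup_induced J.toAssoc

instance (K : KreinSpace.{w}) : ContinuousSMul ℂ K := by
  obtain ⟨J⟩ := (inferInstance : Nonempty K.FundamentalSymmetry)
  rw [strongTopology_eq J]
  exact continuousSMul_induced J.toAssoc

/-- A fundamental symmetry as a continuous operator. -/
def FundamentalSymmetry.toCLM (J : K.FundamentalSymmetry) : K →L[ℂ] K where
  toLinearMap := J.toLin
  cont := by
    let T : J.Assoc →ₗ[ℂ] J.Assoc := J.toAssoc ∘ₗ J.toLin ∘ₗ J.toAssoc.symm
    have hT : ∀ x, ‖T x‖ ≤ 1 * ‖x‖ := fun x => by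
      obtain ⟨x, rfl⟩ := J.toAssoc.surjective x
      have h1 : T (J.toAssoc x) = J.toAssoc (J x) := by simp [T]
      rw [h1, one_mul, ← sq_le_sq₀ (norm_nonneg _) (norm_nonneg _), J.norm_sq_toAssoc,
        J.norm_sq_toAssoc, J.apply_apply, J.form_symm_apply]
    have hc : Continuous T := (T.mkContinuous 1 hT).continuous
    have : (J.toLin : K → K) = J.toAssocL.symm ∘ T ∘ J.toAssocL := by
      funext x
      rfl
    change Continuous (J.toLin : K → K)
    rw [this]
    exact J.toAssocL.symm.continuous.comp (hc.comp J.toAssocL.continuous)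

variable {L : KreinSpace.{w}}

theorem exists_adjoint (T : K →L[ℂ] L) :
    ∃ S : L →L[ℂ] K, ∀ x y, L.form (T x) y = K.form x (S y) := by
  obtain ⟨J⟩ := (inferInstance : Nonempty K.FundamentalSymmetry)
  obtain ⟨J'⟩ := (inferInstance : Nonempty L.FundamentalSymmetry)
  let A : J.Assoc →L[ℂ] J'.Assoc := (J'.toAssocL : L →L[ℂ] J'.Assoc) ∘L T ∘L (J.toAssocL.symm : J.Assoc →L[ℂ] K)
  refine ⟨J.toCLM ∘L (J.toAssocL.symm : J.Assoc →L[ℂ] K) ∘L A.adjoint ∘L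
    (J'.toAssocL : L →L[ℂ] J'.Assoc) ∘L J'.toCLM,
    fun x y => ?_⟩
  have h := A.adjoint_inner_right (J.toAssoc x) (J'.toAssoc (J' y))
  have h1 : inner ℂ (A (J.toAssoc x)) (J'.toAssoc (J' y)) = L.form (T x) y := by
    have : A (J.toAssoc x) = J'.toAssoc (T x) := rfl
    rw [this, J'.inner_toAssoc, J'.apply_apply]
  rw [← h1, ← h]
  rfl

/-- The Krein space adjoint: `⟨T x, y⟩ = ⟨x, T* y⟩`. -/
def adjoint (T : K →L[ℂ] L) : L →L[ℂ] K := (exists_adjoint T).choose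

theorem form_adjoint (T : K →L[ℂ] L) (x : K) (y : L) :
    L.form (T x) y = K.form x (adjoint T y) := (exists_adjoint T).choose_spec x y

theorem eq_of_form_right {x y : K} (h : ∀ z, K.form z x = K.form z y) : x = y :=
  FundamentalSymmetry.eq_of_form_left fun z => by
    rw [← K.form_symm z x, ← K.form_symm z y, h]

theorem eq_adjoint {T : K →L[ℂ] L} {S : L →L[ℂ] K}
    (h : ∀ x y, L.form (T x) y = K.form x (S y)) : adjoint T = S :=
  ContinuousLinearMap.ext fun y => eq_of_form_right fun x => by rw [← form_adjoint, h]

end KreinSpace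

/-! ### The star-category `B(𝔎)` of a family of Krein spaces -/

/-- The objects of the category `B(𝔎)` of a family `𝔎 = (K i)` of Krein spaces: the members of
the family. -/
@[ext] structure BK {ι : Type u} (K : ι → KreinSpace.{w}) : Type u where
  idx : ι

namespace BK

variable {ι : Type u} {K : ι → KreinSpace.{w}}

/-- Morphisms of `B(𝔎)` are the continuous linear maps. -/
instance : Category.{w} (BK K) where
  Hom X Y := K X.idx →L[ℂ] K Y.idx
  id X := ContinuousLinearMap.id ℂ (K X.idx)
  comp S T := ContinuousLinearMap.comp T S

instance : Preadditive (BK K) where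
  homGroup X Y := inferInstanceAs (AddCommGroup (K X.idx →L[ℂ] K Y.idx))
  add_comp _ _ _ S T R := ContinuousLinearMap.comp_add R S T
  comp_add _ _ _ S T R := ContinuousLinearMap.add_comp T R S

instance : Linear ℂ (BK K) where
  homModule X Y := inferInstanceAs (Module ℂ (K X.idx →L[ℂ] K Y.idx))
  smul_comp _ _ _ c S T := ContinuousLinearMap.comp_smul T c S
  comp_smul _ _ _ S c T := ContinuousLinearMap.smul_comp c T S

/-- The involution of `B(𝔎)` is the Krein space adjoint. -/
instance : StarCategory (BK K) where
  star T := KreinSpace.adjoint T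
  star_star {X Y} T := KreinSpace.eq_adjoint fun x y => by
    rw [← (K X.idx).form_symm, ← (K Y.idx).form_symm]
    exact congrArg _ (KreinSpace.form_adjoint T y x).symm
  star_add {X Y} S T := KreinSpace.eq_adjoint fun x y => by
    change (K Y.idx).form (S.toFun x + T.toFun x) y =
      (K X.idx).form x (KreinSpace.adjoint S y + KreinSpace.adjoint T y)
    rw [map_add, map_add, LinearMap.add_apply, ← KreinSpace.form_adjoint,
      ← KreinSpace.form_adjoint]
    rfl
  star_smul {X Y} c T := KreinSpace.eq_adjoint fun x y => by
    change (K Y.idx).form (c • T.toFun x) y =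
      (K X.idx).form x ((starRingEnd ℂ c) • KreinSpace.adjoint T y)
    rw [LinearMap.map_smulₛₗ, map_smul, LinearMap.smul_apply, ← KreinSpace.form_adjoint]
    rfl
  star_comp {X Y Z} S T := KreinSpace.eq_adjoint fun x y => by
    change (K Z.idx).form (T.toFun (S.toFun x)) y =
      (K X.idx).form x (KreinSpace.adjoint S (KreinSpace.adjoint T y))
    rw [← KreinSpace.form_adjoint, ← KreinSpace.form_adjoint]
    rfl

/-- A star-subcategory of `B(𝔎)` is closed if each of its spaces of morphisms is closed in the
topology of bounded convergence of `B(K i, K j)`, which is the one given by the operator norm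
for any choice of fundamental symmetries of `K i` and `K j`. -/
def IsClosedSubcategory (S : StarSubcategory (BK K)) : Prop :=
  ∀ X Y : BK K, IsClosed {T : K X.idx →L[ℂ] K Y.idx | T ∈ S.hom X Y}

/-- `α_J (T) = J T J`, for a family `J` of fundamental symmetries of the Krein spaces of `𝔎`. -/
def conj (J : ∀ i, (K i).FundamentalSymmetry) : Involution (BK K) where
  map {X Y} :=
    { toFun := fun T : K X.idx →L[ℂ] K Y.idx => (J Y.idx).toCLM ∘L T ∘L (J X.idx).toCLM
      map_add' := fun S T => ContinuousLinearMap.ext fun x => map_add (J Y.idx).toCLM _ _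
      map_smul' := fun c T => ContinuousLinearMap.ext fun x => map_smul (J Y.idx).toCLM _ _ }
  map_id X := ContinuousLinearMap.ext fun x => (J X.idx).apply_apply x
  map_comp {X Y Z} S T := ContinuousLinearMap.ext fun x => by
    change (J Z.idx) (T.toFun (S.toFun ((J X.idx) x))) =
      (J Z.idx) (T.toFun ((J Y.idx) ((J Y.idx) (S.toFun ((J X.idx) x)))))
    rw [(J Y.idx).apply_apply]
  map_star {X Y} T := (KreinSpace.eq_adjoint fun x y => by
    change (K Y.idx).form ((J Y.idx) (T.toFun ((J X.idx) x))) y =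
      (K X.idx).form x ((J X.idx) (KreinSpace.adjoint T ((J Y.idx) y)))
    rw [(J Y.idx).form_symm_apply, ← (J X.idx).form_symm_apply, ← KreinSpace.form_adjoint]
    rfl).symm
  map_map {X Y} T := ContinuousLinearMap.ext fun x => by
    change (J Y.idx) ((J Y.idx) (T.toFun ((J X.idx) ((J X.idx) x)))) = T.toFun x
    rw [(J Y.idx).apply_apply, (J X.idx).apply_apply]

end BK

end Krein

end

/-!
Conjugating the involution of `C` by the fundamental symmetry `α` gives the involution `x ↦ α(x*)`,
for which `C` satisfies the C*-identity. The norms are not assumed to be submultiplicative, but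
polarization bounds `‖x y‖` by a constant multiple of `‖x‖ ‖y‖`, and then the norm of a Hermitian
endomorphism is its spectral radius. In particular `α` is isometric.

For a nonzero `x : X ⟶ Y` and `p = α(x*) x`, the Hahn-Banach theorem provides a functional of norm
at most one with value `‖x‖²` at `p`. The spectrum of `p` lies in `[0, ‖x‖²]`, so
`‖2 p - ‖x‖²‖ ≤ ‖x‖²`: this forces the functional to be `1` at the identity, and then to be
positive. Averaging it over `α` loses at most a factor two and gives an `α`-invariant state, on
whose GNS space `α` acts as a self-adjoint unitary `U` implementing `α`. The direct sum of all the
GNS representations is therefore bounded below, hence injective with closed range. Replacing the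
inner product `⟨x, y⟩` of its spaces by `⟨x, U y⟩` turns them into Krein spaces with fundamental
symmetry `U`, and the adjoint of the operator of `x`, which was that of `α(x*)`, becomes that of
`x*`.
-/

noncomputable section

namespace Krein

open StarCategory (star)
open Filter Topology
open scoped NNReal ENNReal

/-! ### Banach norms -/

namespace IsBanachNorm

section Module

variable {V : Type*} [AddCommGroup V] [Module ℂ V] {N : Seminorm ℂ V}

/-- The normed group whose norm is a given Banach norm. -/
abbrev normedAddCommGroup (hN : IsBanachNorm N) : NormedAddCommGroup V :=
  AddGroupNorm.toNormedAddCommGroup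
    { N.toAddGroupSeminorm with eq_zero_of_map_eq_zero' := hN.eq_zero }

theorem completeSpace (hN : IsBanachNorm N) :
    @CompleteSpace V hN.normedAddCommGroup.toMetricSpace.toUniformSpace := by
  let _ := hN.normedAddCommGroup
  refine Metric.complete_of_cauchySeq_tendsto fun s hs => ?_
  obtain ⟨x, hx⟩ := hN.complete s fun ε hε => by
    exact (Metric.cauchySeq_iff.1 hs ε hε).imp fun _ h m hm n hn => by
      exact (dist_eq_norm (s m) (s n)).symm.trans_lt (h m hm n hn)
  exact ⟨x, tendsto_iff_norm_sub_tendsto_zero.2 hx⟩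

theorem smul (hN : IsBanachNorm N) {k : ℝ≥0} (hk : 0 < k) : IsBanachNorm (k • N) where
  eq_zero x hx := hN.eq_zero x ((smul_eq_zero_iff_right hk.ne').1 hx)
  complete s hs := by
    have hk' : (0 : ℝ) < k := hk
    obtain ⟨x, hx⟩ := hN.complete s fun ε hε => by
      obtain ⟨n₀, h₀⟩ := hs (k * ε) (mul_pos hk' hε)
      exact ⟨n₀, fun m hm n hn => lt_of_mul_lt_mul_left (h₀ m hm n hn) hk'.le⟩
    have hkx := hx.const_mul (k : ℝ)
    rw [mul_zero] at hkx
    exact ⟨x, hkx⟩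

theorem comp_linearEquiv {W : Type*} [AddCommGroup W] [Module ℂ W] (hN : IsBanachNorm N)
    (e : W ≃ₗ[ℂ] V) : IsBanachNorm (N.comp (e : W →ₗ[ℂ] V)) where
  eq_zero x hx := e.map_eq_zero_iff.1 (hN.eq_zero _ hx)
  complete s hs := by
    obtain ⟨x, hx⟩ := hN.complete (e ∘ s) fun ε hε => by
      simpa only [Seminorm.comp_apply, LinearEquiv.coe_coe, map_sub, Function.comp_apply]
        using hs ε hε
    exact ⟨e.symm x, by simpa [Function.comp_def] using hx⟩

theorem isClosed_range {W : Type*} [NormedAddCommGroup W] [NormedSpace ℂ W]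
    (hN : IsBanachNorm N) (f : V →ₗ[ℂ] W) {c k : ℝ≥0} (hc : ∀ x, ‖f x‖ ≤ c * N x)
    (hk : ∀ x, N x ≤ k * ‖f x‖) : IsClosed (Set.range f) := by
  let _ := hN.normedAddCommGroup
  let _ : NormedSpace ℂ V := ⟨fun a x => (map_smul_eq_mul N a x).le⟩
  have := hN.completeSpace
  exact ((AddMonoidHomClass.antilipschitz_of_bound f hk).isClosed_range
    (AddMonoidHomClass.uniformContinuous_of_bound f c hc))

end Module

section Algebra

variable {A : Type*} [Ring A] [Algebra ℂ A] {N : Seminorm ℂ A}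

theorem tendsto_norm_pow_spectralRadius (hN : IsBanachNorm N)
    (hmul : ∀ x y, N (x * y) ≤ N x * N y) (a : A) :
    Tendsto (fun n : ℕ => ENNReal.ofReal (N (a ^ n) ^ (1 / n : ℝ))) atTop
      (𝓝 (spectralRadius ℂ a)) := by
  let _ : NormedRing A := { hN.normedAddCommGroup, ‹Ring A› with norm_mul_le := hmul }
  let _ : NormedAlgebra ℂ A :=
    { ‹Algebra ℂ A› with norm_smul_le := fun c x => (map_smul_eq_mul N c x).le }
  have : CompleteSpace A := hN.completeSpace
  exact spectrum.pow_norm_pow_one_div_tendsto_nhds_spectralRadius a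

theorem spectralRadius_eq_ofReal (hN : IsBanachNorm N) {k : ℝ≥0} (hk : 0 < k)
    (hmul : ∀ x y, N (x * y) ≤ k * (N x * N y)) {a : A}
    (hpow : ∀ n : ℕ, N (a ^ 2 ^ n) = N a ^ 2 ^ n) :
    spectralRadius ℂ a = ENNReal.ofReal (N a) := by
  have hk' : (0 : ℝ) < k := hk
  have hmul' : ∀ x y, (k • N) (x * y) ≤ (k • N) x * (k • N) y := fun x y =>
    calc k * N (x * y) ≤ k * (k * (N x * N y)) := mul_le_mul_of_nonneg_left (hmul x y) hk'.le
      _ = k * N x * (k * N y) := by ring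
  have gelfand := ((hN.smul hk).tendsto_norm_pow_spectralRadius hmul' a).comp
    (tendsto_pow_atTop_atTop_of_one_lt (one_lt_two : 1 < 2))
  have limit : Tendsto (fun n : ℕ => (k : ℝ) ^ ((1 / 2 : ℝ) ^ n) * N a) atTop (𝓝 (N a)) := by
    simpa using ((Real.continuousAt_const_rpow hk'.ne').tendsto.comp
      (tendsto_pow_atTop_nhds_zero_of_lt_one (by norm_num : (0 : ℝ) ≤ 1 / 2)
        (by norm_num))).mul_const (N a)
  refine tendsto_nhds_unique gelfand ((ENNReal.tendsto_ofReal limit).congr fun n => ?_)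
  have hexp : (1 / 2 : ℝ) ^ n = ((2 ^ n : ℕ) : ℝ)⁻¹ := by push_cast; simp
  change _ = ENNReal.ofReal ((k * N (a ^ 2 ^ n)) ^ (1 / ((2 ^ n : ℕ) : ℝ)))
  rw [hpow, hexp, one_div, Real.mul_rpow hk'.le (by positivity),
    Real.pow_rpow_inv_natCast (apply_nonneg N a) (by positivity)]

end Algebra

end IsBanachNorm

theorem le_of_forall_pow_two_pow_le {x R K : ℝ} (hR : 0 ≤ R)
    (h : ∀ n : ℕ, x ^ 2 ^ n ≤ K * R ^ 2 ^ n) : x ≤ R := by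
  rcases hR.eq_or_lt with rfl | hR
  · simpa using h 0
  by_contra! hlt
  have hgrowth := (tendsto_pow_atTop_atTop_of_one_lt ((one_lt_div hR).2 hlt)).comp
    (tendsto_pow_atTop_atTop_of_one_lt (one_lt_two : 1 < 2))
  obtain ⟨n, hn⟩ := (hgrowth.eventually (eventually_gt_atTop K)).exists
  rw [Function.comp_apply, div_pow, lt_div_iff₀ (by positivity)] at hn
  exact hn.not_ge (h n)

theorem eq_zero_of_norm_add_sub_le {E : Type*} [NormedAddCommGroup E] [InnerProductSpace ℝ E]
    {x y : E} (hadd : ‖x + y‖ ≤ ‖x‖) (hsub : ‖x - y‖ ≤ ‖x‖) : y = 0 := by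
  have := parallelogram_law_with_norm ℝ x y
  refine norm_le_zero_iff.1 ?_
  nlinarith [norm_nonneg (x + y), norm_nonneg (x - y), norm_nonneg y, norm_nonneg x]

theorem norm_map_le_of_isSymmetric {𝕜 E : Type*} [RCLike 𝕜] [SeminormedAddCommGroup E]
    [InnerProductSpace 𝕜 E] {S : E →ₗ[𝕜] E} (hS : S.IsSymmetric) {a : E} {K R : ℝ} (hR : 0 ≤ R)
    (h : ∀ n : ℕ, ‖(S ^ 2 ^ n) a‖ ≤ K * R ^ 2 ^ n) : ‖S a‖ ≤ R * ‖a‖ := by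
  have sq_le : ∀ n, ‖(S ^ 2 ^ n) a‖ ^ 2 ≤ ‖(S ^ 2 ^ (n + 1)) a‖ * ‖a‖ := fun n => by
    rw [norm_sq_eq_re_inner (𝕜 := 𝕜), hS.pow (2 ^ n), ← Module.End.mul_apply, ← pow_add, ← two_mul,
      ← pow_succ', ← inner_conj_symm, RCLike.conj_re]
    exact re_inner_le_norm _ _
  rcases (norm_nonneg a).eq_or_lt with ha | ha
  · have hSa := sq_le 0
    simp only [pow_zero, pow_one, ← ha, mul_zero, sq_nonpos_iff] at hSa
    rw [hSa, ← ha, mul_zero]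
  have pow_le : ∀ n, (‖S a‖ / ‖a‖) ^ 2 ^ n * ‖a‖ ≤ ‖(S ^ 2 ^ n) a‖ := fun n => by
    induction n with
    | zero => simp [ha.ne']
    | succ n ih =>
      refine le_of_mul_le_mul_right ?_ ha
      calc (‖S a‖ / ‖a‖) ^ 2 ^ (n + 1) * ‖a‖ * ‖a‖ = ((‖S a‖ / ‖a‖) ^ 2 ^ n * ‖a‖) ^ 2 := by ring
        _ ≤ ‖(S ^ 2 ^ n) a‖ ^ 2 := by gcongr
        _ ≤ _ := sq_le n
  rw [← div_le_iff₀ ha]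
  refine le_of_forall_pow_two_pow_le (K := K / ‖a‖) hR fun n => ?_
  rw [div_mul_eq_mul_div, le_div_iff₀ ha]
  exact (pow_le n).trans (h n)

/-! ### The C*-category of a fundamental symmetry -/

section Spectrum

variable {C : Type u} [Category.{v} C] [Preadditive C] {X Y : C}

theorem isIso_id_sub_comp (x : X ⟶ Y) (y : Y ⟶ X) [IsIso (𝟙 Y - y ≫ x)] :
    IsIso (𝟙 X - x ≫ y) := by
  set b := inv (𝟙 Y - y ≫ x) with hb
  have hl : y ≫ x ≫ b = b - 𝟙 Y := by
    have := IsIso.hom_inv_id (𝟙 Y - y ≫ x)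
    rw [← hb, Preadditive.sub_comp, Category.id_comp, Category.assoc] at this
    rw [← this, sub_sub_cancel]
  have hr : b ≫ y ≫ x = b - 𝟙 Y := by
    have := IsIso.inv_hom_id (𝟙 Y - y ≫ x)
    rw [← hb, Preadditive.comp_sub, Category.comp_id] at this
    rw [← this, sub_sub_cancel]
  refine ⟨𝟙 X + x ≫ b ≫ y, ?_, ?_⟩
  · have hl' := congrArg (x ≫ · ≫ y) hl
    simp only [Category.assoc, Preadditive.sub_comp, Preadditive.comp_sub, Category.id_comp] at hl'
    simp [hl']
  · have hr' := congrArg (x ≫ · ≫ y) hr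
    simp only [Category.assoc, Preadditive.sub_comp, Preadditive.comp_sub, Category.id_comp] at hr'
    simp [hr']

theorem mem_spectrum_comp_swap [Linear ℂ C] {x : X ⟶ Y} {y : Y ⟶ X} {μ : ℂ} (hμ : μ ≠ 0)
    (h : μ ∈ spectrum ℂ (A := End X) (x ≫ y)) : μ ∈ spectrum ℂ (A := End Y) (y ≫ x) := by
  have key : ∀ {Z : C} (z : End Z),
      μ ∈ spectrum ℂ z ↔ ¬ IsIso (𝟙 Z - μ⁻¹ • (show Z ⟶ Z from z)) := fun {Z} z => by
    rw [← isUnit_iff_isIso, ← isUnit_smul_iff (Units.mk0 μ hμ), spectrum.mem_iff,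
      Algebra.algebraMap_eq_smul_one]
    simp [Units.smul_def, smul_sub, hμ]
  rw [key] at h ⊢
  contrapose h
  rw [← Linear.comp_smul] at h
  rw [← Linear.smul_comp]
  exact isIso_id_sub_comp _ _

end Spectrum

namespace Involution

variable {C : Type u} [Category.{v} C] [Preadditive C] [Linear ℂ C] [StarCategory C]

section Dag

variable (α : Involution C) {X Y Z : C}

/-- The involution `x ↦ α(x*)` of `C`. -/
def dag : (X ⟶ Y) →ₗ⋆[ℂ] (Y ⟶ X) where
  toFun x := α.map (star x)
  map_add' x y := by rw [StarCategory.star_add, map_add]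
  map_smul' c x := by rw [StarCategory.star_smul, map_smul]

theorem dag_dag (x : X ⟶ Y) : α.dag (α.dag x) = x := by
  change α.map (star (α.map (star x))) = x
  rw [← α.map_star, α.map_map, StarCategory.star_star]

theorem dag_comp (x : X ⟶ Y) (y : Y ⟶ Z) : α.dag (x ≫ y) = α.dag y ≫ α.dag x := by
  change α.map (star (x ≫ y)) = _
  rw [StarCategory.star_comp, α.map_comp]
  rfl

theorem dag_comp_dag_self (x : X ⟶ Y) : α.dag (x ≫ α.dag x) = x ≫ α.dag x := by
  rw [dag_comp, dag_dag]

theorem dag_id (X : C) : α.dag (𝟙 X) = 𝟙 X := by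
  simpa [dag_dag] using (α.dag_comp (α.dag (𝟙 X)) (𝟙 X)).symm

theorem map_dag (x : X ⟶ Y) : α.map (α.dag x) = α.dag (α.map x) :=
  congrArg α.map (α.map_star x)

theorem dag_pow {h : End X} (hh : α.dag h = h) (n : ℕ) :
    α.dag (h ^ n : End X) = (h ^ n : End X) := by
  induction n with
  | zero => exact α.dag_id X
  | succ n ih =>
    rw [pow_succ, End.mul_def, dag_comp, hh, ih]
    exact (pow_mul_comm' h n).symm

theorem comp_dag_polarization (x y : X ⟶ Y) :
    (4 : ℂ) • (y ≫ α.dag x) = ∑ k ∈ Finset.range 4,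
      Complex.I ^ k • ((y + Complex.I ^ k • x) ≫ α.dag (y + Complex.I ^ k • x)) := by
  simp only [Finset.sum_range_succ, Finset.sum_range_zero, pow_zero, pow_one, Complex.I_sq,
    Complex.I_pow_three, map_add, LinearMap.map_smulₛₗ, map_neg, map_one, Complex.conj_I,
    Preadditive.add_comp, Preadditive.comp_add, Linear.smul_comp, Linear.comp_smul]
  match_scalars <;> ring_nf <;> norm_num [Complex.I_sq]

/-- `α` as an automorphism of the algebra of endomorphisms of an object. -/
def endEquiv (X : C) : End X ≃ₐ[ℂ] End X :=
  AlgEquiv.ofLinearEquiv (LinearEquiv.ofInvolutive (α.map : (X ⟶ X) →ₗ[ℂ] (X ⟶ X)) α.map_map)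
    (α.map_id X) fun x y => α.map_comp y x

end Dag

/-- The norms `N` and the involution `α.dag` make `C` a C*-category: `N` is a witness that `α` is
a fundamental symmetry. -/
structure IsCStarNorm (α : Involution C) (N : ∀ X Y : C, Seminorm ℂ (X ⟶ Y)) : Prop where
  banach : ∀ X Y, IsBanachNorm (N X Y)
  cstar : ∀ {X Y : C} (x : X ⟶ Y), N X X (x ≫ α.dag x) = N X Y x ^ 2
  pos : ∀ {X Y : C} (x : X ⟶ Y), α.IsPositive (x ≫ α.dag x)

theorem IsFundamentalSymmetry.exists_isCStarNorm {α : Involution C}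
    (hα : α.IsFundamentalSymmetry) : ∃ N : ∀ X Y : C, Seminorm ℂ (X ⟶ Y), α.IsCStarNorm N := by
  obtain ⟨⟨N, banach, cstar⟩, pos⟩ := hα
  exact ⟨N, banach, cstar, pos⟩

namespace IsCStarNorm

variable {α : Involution C} {N : ∀ X Y : C, Seminorm ℂ (X ⟶ Y)} (hN : α.IsCStarNorm N)
  {X Y Z : C}

include hN

theorem norm_id_le (X : C) : N X X (𝟙 X) ≤ 1 := by
  have h := hN.cstar (𝟙 X)
  rw [α.dag_id, Category.comp_id] at h
  nlinarith [apply_nonneg (N X X) (𝟙 X)]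

theorem norm_comp_dag_le_sq (x y : X ⟶ Y) :
    N X X (y ≫ α.dag x) ≤ (N X Y y + N X Y x) ^ 2 := by
  have term_le : ∀ k : ℕ, N X X (Complex.I ^ k •
      ((y + Complex.I ^ k • x) ≫ α.dag (y + Complex.I ^ k • x))) ≤ (N X Y y + N X Y x) ^ 2 :=
    fun k => by
      have hI : ∀ {W : C} (z : X ⟶ W), N X W (Complex.I ^ k • z) = N X W z := fun z => by
        simp [map_smul_eq_mul]
      rw [hI, hN.cstar, ← hI x]
      exact pow_le_pow_left₀ (apply_nonneg _ _) (map_add_le_add _ _ _) 2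
  have four_le : 4 * N X X (y ≫ α.dag x) ≤ 4 * (N X Y y + N X Y x) ^ 2 :=
    calc 4 * N X X (y ≫ α.dag x) = N X X ((4 : ℂ) • (y ≫ α.dag x)) := by
          simp [map_smul_eq_mul]
      _ ≤ ∑ k ∈ Finset.range 4, N X X (Complex.I ^ k •
          ((y + Complex.I ^ k • x) ≫ α.dag (y + Complex.I ^ k • x))) := by
        rw [α.comp_dag_polarization]
        exact Finset.le_sum_of_subadditive _ (map_zero _).le (map_add_le_add _) _ _
      _ ≤ 4 * (N X Y y + N X Y x) ^ 2 := by
        simpa using Finset.sum_le_sum fun k (_ : k ∈ Finset.range 4) => term_le k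
  linarith

theorem norm_comp_dag_le (x y : X ⟶ Y) :
    N X X (y ≫ α.dag x) ≤ 4 * (N X Y y * N X Y x) := by
  rcases (apply_nonneg (N X Y) x).eq_or_lt with hx | hx
  · simp [(hN.banach X Y).eq_zero x hx.symm]
  rcases (apply_nonneg (N X Y) y).eq_or_lt with hy | hy
  · simp [(hN.banach X Y).eq_zero y hy.symm]
  have h := hN.norm_comp_dag_le_sq x (((N X Y x / N X Y y : ℝ) : ℂ) • y)
  rw [Linear.smul_comp, map_smul_eq_mul, map_smul_eq_mul, Complex.norm_real, Real.norm_of_nonneg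
    (by positivity), div_mul_cancel₀ _ hy.ne', div_mul_eq_mul_div, div_le_iff₀ hy] at h
  refine le_of_mul_le_mul_left ?_ hx
  linarith

theorem norm_end_mul_le (x y : End X) : N X X (x * y) ≤ 16 * (N X X x * N X X y) := by
  have := apply_nonneg (N X X) x
  have := apply_nonneg (N X X) y
  have hdag : N X X (α.dag x) ≤ 4 * N X X x := by
    have := hN.norm_comp_dag_le x (𝟙 X)
    rw [Category.id_comp] at this
    nlinarith [hN.norm_id_le X]
  calc N X X (x * y) = N X X (y ≫ α.dag (α.dag x)) := by rw [α.dag_dag]; rfl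
    _ ≤ 4 * (N X X y * N X X (α.dag x)) := hN.norm_comp_dag_le _ _
    _ ≤ 4 * (N X X y * (4 * N X X x)) := by gcongr
    _ = 16 * (N X X x * N X X y) := by ring

theorem norm_pow_two_pow {h : End X} (hh : α.dag h = h) (n : ℕ) :
    N X X (h ^ 2 ^ n : End X) = N X X h ^ 2 ^ n := by
  induction n with
  | zero => simp
  | succ n ih =>
    have := hN.cstar (h ^ 2 ^ n : End X)
    rwa [α.dag_pow hh, ← End.mul_def, ← sq, ← pow_mul, ← pow_succ, ih, ← pow_mul,
      ← pow_succ] at this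

theorem norm_le_iff_forall_spectrum {h : End X} (hh : α.dag h = h) {R : ℝ} (hR : 0 ≤ R) :
    N X X h ≤ R ↔ ∀ μ ∈ spectrum ℂ h, ‖μ‖ ≤ R := by
  rw [← ENNReal.ofReal_le_ofReal_iff hR, ← (hN.banach X X).spectralRadius_eq_ofReal
    (k := 16) (by norm_num) hN.norm_end_mul_le (hN.norm_pow_two_pow hh)]
  simp only [spectralRadius, iSup₂_le_iff, ← enorm_eq_nnnorm, ← ofReal_norm,
    ENNReal.ofReal_le_ofReal_iff hR]

theorem norm_of_mem_spectrum_le {h : End X} (hh : α.dag h = h) {μ : ℂ} (hμ : μ ∈ spectrum ℂ h) :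
    ‖μ‖ ≤ N X X h :=
  (hN.norm_le_iff_forall_spectrum hh (apply_nonneg _ _)).1 le_rfl μ hμ

theorem norm_le_norm_dag (x : X ⟶ Y) : N X Y x ≤ N Y X (α.dag x) := by
  rw [← sq_le_sq₀ (apply_nonneg _ _) (apply_nonneg _ _), ← hN.cstar x,
    hN.norm_le_iff_forall_spectrum (α.dag_comp_dag_self x) (by positivity)]
  intro μ hμ
  rcases eq_or_ne μ 0 with rfl | hμ0
  · rw [norm_zero]; positivity
  have h := hN.norm_of_mem_spectrum_le (α.dag_comp_dag_self (α.dag x))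
    (by rw [α.dag_dag]; exact mem_spectrum_comp_swap hμ0 hμ)
  rwa [hN.cstar] at h

theorem norm_dag (x : X ⟶ Y) : N Y X (α.dag x) = N X Y x :=
  le_antisymm (by simpa only [dag_dag] using hN.norm_le_norm_dag (α.dag x)) (hN.norm_le_norm_dag x)

theorem norm_map_le (x : X ⟶ Y) : N X Y (α.map x) ≤ N X Y x := by
  rw [← sq_le_sq₀ (apply_nonneg _ _) (apply_nonneg _ _), ← hN.cstar x, ← hN.cstar,
    hN.norm_le_iff_forall_spectrum (α.dag_comp_dag_self _) (apply_nonneg _ _)]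
  intro μ hμ
  rw [← α.map_dag, ← α.map_comp] at hμ
  refine hN.norm_of_mem_spectrum_le (α.dag_comp_dag_self x) ?_
  rwa [← AlgEquiv.spectrum_eq (α.endEquiv X)]

theorem norm_comp_end_le (x : X ⟶ Y) (y : End Y) : N X Y (x ≫ y) ≤ 4 * (N X Y x * N Y Y y) := by
  have := apply_nonneg (N X Y) x
  have := apply_nonneg (N Y Y) y
  have hdag : ∀ z : End Y, N Y Y (z ≫ y) ≤ 4 * (N Y Y z * N Y Y y) := fun z => by
    simpa only [α.dag_dag, hN.norm_dag] using hN.norm_comp_dag_le (α.dag y) z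
  have hxx : N Y Y (α.dag x ≫ x) = N X Y x ^ 2 := by
    rw [← hN.norm_dag x, ← hN.cstar, α.dag_dag]
  rw [← sq_le_sq₀ (apply_nonneg _ _) (by positivity)]
  calc N X Y (x ≫ y) ^ 2 = N Y Y (α.dag y ≫ α.dag (α.dag ((α.dag x ≫ x) ≫ y))) := by
        rw [← hN.norm_dag (x ≫ y), ← hN.cstar]
        simp only [α.dag_dag, α.dag_comp, Category.assoc]
    _ ≤ 4 * (N Y Y y * N Y Y ((α.dag x ≫ x) ≫ y)) := by
      simpa only [hN.norm_dag] using hN.norm_comp_dag_le (α.dag ((α.dag x ≫ x) ≫ y)) (α.dag y)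
    _ ≤ 4 * (N Y Y y * (4 * (N X Y x ^ 2 * N Y Y y))) := by
      rw [← hxx]
      gcongr
      exact hdag _
    _ = (4 * (N X Y x * N Y Y y)) ^ 2 := by ring

theorem norm_two_smul_comp_dag_sub_le (x : X ⟶ Y) :
    N X X ((2 : ℂ) • (x ≫ α.dag x) - ((N X Y x ^ 2 : ℝ) : ℂ) • 𝟙 X) ≤ N X Y x ^ 2 := by
  set n := N X Y x ^ 2
  rw [hN.norm_le_iff_forall_spectrum (by
    simp only [map_sub, LinearMap.map_smulₛₗ, α.dag_comp_dag_self, dag_id, Complex.conj_ofReal,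
      map_ofNat]) (by positivity)]
  intro μ hμ
  let p : End X := x ≫ α.dag x
  change μ ∈ spectrum ℂ (Units.mk0 (2 : ℂ) two_ne_zero • p - algebraMap ℂ (End X) (n : ℂ)) at hμ
  rw [← spectrum.sub_singleton_eq, spectrum.unit_smul_eq_smul] at hμ
  obtain ⟨_, ⟨t, ht, rfl⟩, _, rfl, rfl⟩ := hμ
  obtain ⟨ht_nonneg, ht_im⟩ := (hN.pos x).2 t ht
  have ht_le : t.re ≤ n := (Complex.re_le_norm t).trans <| by
    simpa only [hN.cstar] using hN.norm_of_mem_spectrum_le (α.dag_comp_dag_self x) ht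
  have ht_real : t = (t.re : ℂ) := Complex.ext rfl ht_im
  change ‖2 * t - n‖ ≤ n
  rw [ht_real, ← Complex.ofReal_ofNat, ← Complex.ofReal_mul, ← Complex.ofReal_sub,
    Complex.norm_real, Real.norm_eq_abs, abs_le]
  constructor <;> linarith

end IsCStarNorm

end Involution

/-! ### Invariant states -/

theorem norm_half_smul_add_le {E : Type*} [SeminormedAddCommGroup E] [NormedSpace ℂ E] {a b : E}
    {r : ℝ} (ha : ‖a‖ ≤ r) (hb : ‖b‖ ≤ r) : ‖(1 / 2 : ℂ) • (a + b)‖ ≤ r := by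
  have := norm_add_le a b
  rw [norm_smul, norm_div, norm_one, Complex.norm_ofNat]
  linarith

namespace Involution

variable {C : Type u} [Category.{v} C] [Preadditive C] [Linear ℂ C] [StarCategory C]
  {α : Involution C} {N : ∀ X Y : C, Seminorm ℂ (X ⟶ Y)}

/-- An `α`-invariant state of the C*-algebra of endomorphisms of `X` with norm `N X X` and
involution `α.dag`. Positivity is required on the elements `x†x` for all morphisms `x` out of `X`,
as the GNS construction uses all the spaces `X ⟶ Y`. -/
structure InvariantState (α : Involution C) (N : ∀ X Y : C, Seminorm ℂ (X ⟶ Y)) (X : C) where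
  toLin : (X ⟶ X) →ₗ[ℂ] ℂ
  map_one : toLin (𝟙 X) = 1
  dag_apply : ∀ h, toLin (α.dag h) = starRingEnd ℂ (toLin h)
  map_apply : ∀ h, toLin (α.map h) = toLin h
  nonneg : ∀ {Y : C} (x : X ⟶ Y), 0 ≤ (toLin (x ≫ α.dag x)).re
  norm_le : ∀ h, ‖toLin h‖ ≤ N X X h

namespace IsCStarNorm

variable (hN : α.IsCStarNorm N) {X Y : C}

include hN

theorem re_nonneg_of_norm_le {g : (X ⟶ X) →ₗ[ℂ] ℂ} (hg : ∀ h, ‖g h‖ ≤ N X X h)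
    (hg1 : g (𝟙 X) = 1) (x : X ⟶ Y) : 0 ≤ (g (x ≫ α.dag x)).re := by
  have h := (Complex.abs_re_le_norm _).trans
    ((hg _).trans (hN.norm_two_smul_comp_dag_sub_le x))
  rw [map_sub, map_smul, map_smul, hg1, abs_le] at h
  simp only [smul_eq_mul, mul_one, Complex.sub_re, Complex.mul_re, Complex.ofReal_re,
    Complex.re_ofNat, Complex.im_ofNat, zero_mul, sub_zero] at h
  linarith

theorem map_id_eq_one_of_norm_le {g : (X ⟶ X) →ₗ[ℂ] ℂ} (hg : ∀ h, ‖g h‖ ≤ N X X h) {x : X ⟶ Y}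
    (hx : x ≠ 0) (hgx : g (x ≫ α.dag x) = (N X Y x ^ 2 : ℝ)) : g (𝟙 X) = 1 := by
  have hNx : 0 < N X Y x ^ 2 := by
    have := (apply_nonneg (N X Y) x).lt_of_ne' fun h => hx ((hN.banach X Y).eq_zero x h)
    positivity
  have norm_two_sub_le : ‖2 - g (𝟙 X)‖ ≤ 1 := by
    have h := (hg _).trans (hN.norm_two_smul_comp_dag_sub_le x)
    rw [map_sub, map_smul, map_smul, hgx, smul_eq_mul, smul_eq_mul, mul_comm, ← mul_sub,
      norm_mul, Complex.norm_real, Real.norm_of_nonneg hNx.le] at h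
    exact le_of_mul_le_mul_left (h.trans_eq (mul_one _).symm) hNx
  have norm_le_one : ‖g (𝟙 X)‖ ≤ 1 := (hg _).trans (hN.norm_id_le X)
  refine (sub_eq_zero.1 (eq_zero_of_norm_add_sub_le (x := (1 : ℂ)) ?_ ?_)).symm
  · rwa [← add_sub_assoc, one_add_one_eq_two, norm_one]
  · rwa [sub_sub_cancel, norm_one]

theorem exists_norming_functional {x : X ⟶ Y} (hx : x ≠ 0) :
    ∃ g : (X ⟶ X) →ₗ[ℂ] ℂ, (∀ h, ‖g h‖ ≤ N X X h) ∧ g (𝟙 X) = 1 ∧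
      g (x ≫ α.dag x) = (N X Y x ^ 2 : ℝ) := by
  let _ := (hN.banach X X).normedAddCommGroup
  let _ : NormedSpace ℂ (X ⟶ X) := ⟨fun c h => (map_smul_eq_mul (N X X) c h).le⟩
  obtain ⟨g, hg_norm, hgx⟩ := exists_dual_vector'' ℂ (x ≫ α.dag x)
  have hg : ∀ h, ‖g h‖ ≤ N X X h := fun h => g.le_of_opNorm_le_of_le hg_norm le_rfl |>.trans_eq
    (one_mul _)
  have hgx' : g (x ≫ α.dag x) = (N X Y x ^ 2 : ℝ) := by rw [← hN.cstar x]; exact hgx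
  exact ⟨g, hg, hN.map_id_eq_one_of_norm_le (g := g) hg hx hgx', hgx'⟩

theorem exists_hermitian_norming_functional {x : X ⟶ Y} (hx : x ≠ 0) :
    ∃ g : (X ⟶ X) →ₗ[ℂ] ℂ, (∀ h, ‖g h‖ ≤ N X X h) ∧ g (𝟙 X) = 1 ∧
      g (x ≫ α.dag x) = (N X Y x ^ 2 : ℝ) ∧ ∀ h, g (α.dag h) = starRingEnd ℂ (g h) := by
  obtain ⟨g, hg, hg1, hgx⟩ := hN.exists_norming_functional hx
  refine ⟨(1 / 2 : ℂ) • (g + (starRingEnd ℂ).toSemilinearMap ∘ₛₗ g ∘ₛₗ α.dag), fun h => ?_, ?_, ?_,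
    fun h => ?_⟩
  · refine norm_half_smul_add_le (hg h) ?_
    simpa [hN.norm_dag] using hg (α.dag h)
  · norm_num [hg1, α.dag_id]
  · change (1 / 2 : ℂ) • (g _ + starRingEnd ℂ (g (α.dag _))) = _
    rw [α.dag_comp_dag_self, hgx, Complex.conj_ofReal, smul_eq_mul]
    ring
  · simp [α.dag_dag, add_comm, Complex.conj_ofNat]

theorem exists_invariantState {x : X ⟶ Y} (hx : x ≠ 0) :
    ∃ φ : α.InvariantState N X, N X Y x ^ 2 ≤ 2 * (φ.toLin (x ≫ α.dag x)).re := by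
  obtain ⟨g, hg, hg1, hgx, hg_dag⟩ := hN.exists_hermitian_norming_functional hx
  let φ : (X ⟶ X) →ₗ[ℂ] ℂ := (1 / 2 : ℂ) • (g + g ∘ₗ α.map)
  have hφ : ∀ h, ‖φ h‖ ≤ N X X h := fun h =>
    norm_half_smul_add_le (hg h) ((hg _).trans (hN.norm_map_le h))
  have hφ1 : φ (𝟙 X) = 1 := by
    norm_num [φ, hg1, α.map_id]
  refine ⟨⟨φ, hφ1, fun h => ?_, fun h => ?_, hN.re_nonneg_of_norm_le hφ hφ1, hφ⟩, ?_⟩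
  · simp [φ, α.map_dag, hg_dag, Complex.conj_ofNat]
  · simp [φ, α.map_map, add_comm]
  · have hmap := hN.re_nonneg_of_norm_le hg hg1 (α.map x)
    rw [← α.map_dag, ← α.map_comp] at hmap
    have hφx : 2 * φ (x ≫ α.dag x) = (N X Y x ^ 2 : ℝ) + g (α.map (x ≫ α.dag x)) := by
      simp only [φ, LinearMap.smul_apply, LinearMap.add_apply, LinearMap.comp_apply, hgx,
        smul_eq_mul]
      ring
    have := congrArg Complex.re hφx
    simp only [Complex.mul_re, Complex.re_ofNat, Complex.im_ofNat, zero_mul, sub_zero,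
      Complex.add_re, Complex.ofReal_re] at this
    linarith

end IsCStarNorm

end Involution

/-! ### The GNS representation of an invariant state -/

theorem norm_map_of_involutive_of_isSymmetric {𝕜 E : Type*} [RCLike 𝕜] [SeminormedAddCommGroup E]
    [InnerProductSpace 𝕜 E] {U : E →ₗ[𝕜] E} (hU : Function.Involutive U) (hs : U.IsSymmetric)
    (x : E) : ‖U x‖ = ‖x‖ := by
  rw [← sq_eq_sq₀ (norm_nonneg _) (norm_nonneg _), norm_sq_eq_re_inner (𝕜 := 𝕜), hs, hU,
    norm_sq_eq_re_inner (𝕜 := 𝕜)]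

namespace Involution

variable {C : Type u} [Category.{v} C] [Preadditive C] [Linear ℂ C] [StarCategory C]
  {α : Involution C} {N : ∀ X Y : C, Seminorm ℂ (X ⟶ Y)}

namespace InvariantState

variable {X : C} (φ : α.InvariantState N X)

/-- The semi-inner product `⟨a, b⟩ = φ(a†b)` on `X ⟶ Y` given by an invariant state `φ`. -/
@[reducible] def core (Y : C) : PreInnerProductSpace.Core ℂ (X ⟶ Y) where
  inner a b := φ.toLin (b ≫ α.dag a)
  conj_inner_symm a b := by rw [← φ.dag_apply, dag_comp, dag_dag]
  re_inner_nonneg a := φ.nonneg a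
  add_left a b c := by rw [map_add, Preadditive.comp_add, map_add]
  smul_left a b c := by rw [LinearMap.map_smulₛₗ, Linear.comp_smul, map_smul, smul_eq_mul]

/-- A copy of the space `X ⟶ Y`, with the semi-inner product of an invariant state of `End X`. -/
@[nolint unusedArguments]
def PreGNS (_ : α.InvariantState N X) (Y : C) : Type v := X ⟶ Y

namespace PreGNS

variable (Y Z : C)

instance : AddCommGroup (φ.PreGNS Y) := inferInstanceAs (AddCommGroup (X ⟶ Y))

instance : Module ℂ (φ.PreGNS Y) := inferInstanceAs (Module ℂ (X ⟶ Y))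

instance innerCore : PreInnerProductSpace.Core ℂ (φ.PreGNS Y) := φ.core Y

instance : SeminormedAddCommGroup (φ.PreGNS Y) :=
  InnerProductSpace.Core.toSeminormedAddCommGroup (𝕜 := ℂ)

instance : InnerProductSpace ℂ (φ.PreGNS Y) := InnerProductSpace.ofCore (innerCore φ Y)

/-- A vector of the semi-inner product space as a morphism. -/
def toHom : φ.PreGNS Y ≃ₗ[ℂ] (X ⟶ Y) := LinearEquiv.refl ℂ (X ⟶ Y)

/-- Composition with a morphism `Y ⟶ Z`, as a linear map between the semi-inner product spaces. -/
def postcomp : (Y ⟶ Z) →ₗ[ℂ] φ.PreGNS Y →ₗ[ℂ] φ.PreGNS Z := (Linear.comp X Y Z).flip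

/-- The involution `α`, as a linear map on the semi-inner product space. -/
def symm : φ.PreGNS Y →ₗ[ℂ] φ.PreGNS Y := (α.map : (X ⟶ Y) →ₗ[ℂ] (X ⟶ Y))

variable {φ Y Z}

theorem inner_def (a b : φ.PreGNS Y) : inner ℂ a b = φ.toLin (toHom φ Y b ≫ α.dag (toHom φ Y a)) :=
  rfl

theorem norm_sq_eq (a : φ.PreGNS Y) : ‖a‖ ^ 2 = (φ.toLin (toHom φ Y a ≫ α.dag (toHom φ Y a))).re :=
  norm_sq_eq_re_inner (𝕜 := ℂ) a

theorem toHom_postcomp (T : Y ⟶ Z) (a : φ.PreGNS Y) :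
    toHom φ Z (postcomp φ Y Z T a) = toHom φ Y a ≫ T := rfl

theorem toHom_symm (a : φ.PreGNS Y) : toHom φ Y (symm φ Y a) = α.map (toHom φ Y a) := rfl

theorem postcomp_id (a : φ.PreGNS Y) : postcomp φ Y Y (𝟙 Y) a = a :=
  (toHom φ Y).injective (Category.comp_id _)

theorem postcomp_comp {W : C} (S : Y ⟶ Z) (T : Z ⟶ W) (a : φ.PreGNS Y) :
    postcomp φ Y W (S ≫ T) a = postcomp φ Z W T (postcomp φ Y Z S a) :=
  (toHom φ W).injective (Category.assoc _ _ _).symm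

theorem inner_postcomp (T : Y ⟶ Z) (a : φ.PreGNS Y) (b : φ.PreGNS Z) :
    inner ℂ (postcomp φ Y Z T a) b = inner ℂ a (postcomp φ Z Y (α.dag T) b) := by
  rw [inner_def, inner_def, toHom_postcomp, toHom_postcomp, dag_comp, Category.assoc]

theorem postcomp_pow_apply (h : End Y) (n : ℕ) (a : φ.PreGNS Y) :
    (postcomp φ Y Y h ^ n) a = postcomp φ Y Y (h ^ n : End Y) a := by
  induction n with
  | zero => exact (postcomp_id a).symm
  | succ n ih => rw [pow_succ', Module.End.mul_apply, ih, pow_succ', End.mul_def, postcomp_comp]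

theorem involutive_symm : Function.Involutive (symm φ Y) := fun _ =>
  (toHom φ Y).injective (α.map_map _)

theorem isSymmetric_symm : (symm φ Y).IsSymmetric := fun a b => by
  rw [inner_def, inner_def, toHom_symm, toHom_symm, ← φ.map_apply, α.map_comp, α.map_dag, α.map_map]

theorem norm_symm (a : φ.PreGNS Y) : ‖symm φ Y a‖ = ‖a‖ :=
  norm_map_of_involutive_of_isSymmetric involutive_symm isSymmetric_symm a

theorem postcomp_map (T : Y ⟶ Z) (a : φ.PreGNS Y) :
    postcomp φ Y Z (α.map T) a = symm φ Z (postcomp φ Y Z T (symm φ Y a)) := by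
  refine (toHom φ Z).injective ?_
  rw [toHom_symm, toHom_postcomp, toHom_postcomp, toHom_symm, α.map_comp, α.map_map]

variable (hN : α.IsCStarNorm N)

include hN

theorem norm_le (a : φ.PreGNS Y) : ‖a‖ ≤ N X Y (toHom φ Y a) := by
  rw [← sq_le_sq₀ (norm_nonneg _) (apply_nonneg _ _), ← hN.cstar, norm_sq_eq]
  exact (Complex.re_le_norm _).trans (φ.norm_le _)

theorem norm_postcomp_comp_dag_le (T : Y ⟶ Z) (a : φ.PreGNS Y) :
    ‖postcomp φ Y Y (T ≫ α.dag T) a‖ ≤ N Y Z T ^ 2 * ‖a‖ := by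
  have hS : (postcomp φ Y Y (T ≫ α.dag T)).IsSymmetric := fun a b => by
    rw [inner_postcomp, α.dag_comp_dag_self]
  refine norm_map_le_of_isSymmetric hS (K := 4 * N X Y (toHom φ Y a)) (by positivity) fun n => ?_
  rw [postcomp_pow_apply (T ≫ α.dag T : End Y), mul_assoc, ← hN.cstar,
    ← hN.norm_pow_two_pow (α.dag_comp_dag_self T)]
  exact (norm_le hN _).trans (hN.norm_comp_end_le _ _)

theorem norm_postcomp_le (T : Y ⟶ Z) (a : φ.PreGNS Y) :
    ‖postcomp φ Y Z T a‖ ≤ N Y Z T * ‖a‖ := by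
  rw [← sq_le_sq₀ (norm_nonneg _) (mul_nonneg (apply_nonneg _ _) (norm_nonneg _))]
  calc ‖postcomp φ Y Z T a‖ ^ 2 = RCLike.re (inner ℂ a (postcomp φ Y Y (T ≫ α.dag T) a)) := by
        rw [norm_sq_eq_re_inner (𝕜 := ℂ), inner_postcomp, postcomp_comp]
    _ ≤ ‖a‖ * ‖postcomp φ Y Y (T ≫ α.dag T) a‖ := re_inner_le_norm _ _
    _ ≤ ‖a‖ * (N Y Z T ^ 2 * ‖a‖) := by gcongr; exact norm_postcomp_comp_dag_le hN T a
    _ = (N Y Z T * ‖a‖) ^ 2 := by ring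

end PreGNS

end InvariantState

/-- A representation of `C` by bounded operators between Hilbert spaces, contractive for the norms
`N`, that turns the involution `α.dag` into the Hilbert space adjoint and `α` into the conjugation
by self-adjoint unitaries `symm A`. -/
structure CovariantRep (α : Involution C) (N : ∀ X Y : C, Seminorm ℂ (X ⟶ Y)) where
  space : C → Type w
  [normedAddCommGroup : ∀ A, NormedAddCommGroup (space A)]
  [innerProductSpace : ∀ A, InnerProductSpace ℂ (space A)]
  [completeSpace : ∀ A, CompleteSpace (space A)]
  rep {A B : C} : (A ⟶ B) →ₗ[ℂ] (space A →L[ℂ] space B)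
  symm (A : C) : space A →L[ℂ] space A
  rep_id {A : C} (a : space A) : rep (𝟙 A) a = a
  rep_comp {A B D : C} (S : A ⟶ B) (T : B ⟶ D) (a : space A) : rep (S ≫ T) a = rep T (rep S a)
  inner_rep {A B : C} (T : A ⟶ B) (a : space A) (b : space B) :
    inner ℂ (rep T a) b = inner ℂ a (rep (α.dag T) b)
  symm_symm {A : C} (a : space A) : symm A (symm A a) = a
  isSymmetric_symm (A : C) : (symm A : space A →ₗ[ℂ] space A).IsSymmetric
  rep_map {A B : C} (T : A ⟶ B) (a : space A) : rep (α.map T) a = symm B (rep T (symm A a))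
  norm_rep_le {A B : C} (T : A ⟶ B) : ‖rep T‖ ≤ N A B T

attribute [instance] CovariantRep.normedAddCommGroup CovariantRep.innerProductSpace
  CovariantRep.completeSpace

namespace InvariantState

open UniformSpace

variable {X : C} (φ : α.InvariantState N X) (hN : α.IsCStarNorm N)

/-- Composition with a morphism `Y ⟶ Z`, as an operator between the completions of the spaces of
morphisms out of `X`. -/
def gnsOperator {Y Z : C} (T : Y ⟶ Z) :
    Completion (φ.PreGNS Y) →L[ℂ] Completion (φ.PreGNS Z) :=
  ((PreGNS.postcomp φ Y Z T).mkContinuous (N Y Z T) (PreGNS.norm_postcomp_le hN T)).completion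

theorem gnsOperator_coe {Y Z : C} (T : Y ⟶ Z) (a : φ.PreGNS Y) :
    φ.gnsOperator hN T (a : Completion (φ.PreGNS Y)) = PreGNS.postcomp φ Y Z T a :=
  ContinuousLinearMap.completion_apply_coe _ a

theorem norm_gnsOperator_le {Y Z : C} (T : Y ⟶ Z) : ‖φ.gnsOperator hN T‖ ≤ N Y Z T := by
  refine ContinuousLinearMap.opNorm_le_bound _ (apply_nonneg _ _) fun a => ?_
  induction a using Completion.induction_on with
  | hp => exact isClosed_le (by fun_prop) (by fun_prop)
  | ih a =>
    rw [gnsOperator_coe, Completion.norm_coe, Completion.norm_coe]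
    exact PreGNS.norm_postcomp_le hN T a

/-- The involution `α` on the completion of the space of morphisms from `X` to `Y`. -/
def gnsSymm (Y : C) : Completion (φ.PreGNS Y) →L[ℂ] Completion (φ.PreGNS Y) :=
  ((PreGNS.symm φ Y).mkContinuous 1 fun a => by rw [one_mul, PreGNS.norm_symm]).completion

theorem gnsSymm_coe {Y : C} (a : φ.PreGNS Y) :
    φ.gnsSymm Y (a : Completion (φ.PreGNS Y)) = PreGNS.symm φ Y a :=
  ContinuousLinearMap.completion_apply_coe _ a

theorem gnsOperator_add {Y Z : C} (S T : Y ⟶ Z) :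
    φ.gnsOperator hN (S + T) = φ.gnsOperator hN S + φ.gnsOperator hN T := by
  ext a
  induction a using Completion.induction_on with
  | hp => exact isClosed_eq (by fun_prop) (by fun_prop)
  | ih a =>
    rw [add_apply, gnsOperator_coe, gnsOperator_coe, gnsOperator_coe, map_add,
      LinearMap.add_apply, Completion.coe_add]

theorem gnsOperator_smul {Y Z : C} (c : ℂ) (T : Y ⟶ Z) :
    φ.gnsOperator hN (c • T) = c • φ.gnsOperator hN T := by
  ext a
  induction a using Completion.induction_on with
  | hp =>
    exact isClosed_eq (φ.gnsOperator hN (c • T)).continuous (c • φ.gnsOperator hN T).continuous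
  | ih a =>
    rw [smul_apply, gnsOperator_coe, gnsOperator_coe, map_smul,
      LinearMap.smul_apply, Completion.coe_smul]

/-- The GNS representation of an invariant state, on the completions of the spaces of morphisms
out of `X`. -/
def gns : α.CovariantRep N where
  space Y := Completion (φ.PreGNS Y)
  rep :=
    { toFun := φ.gnsOperator hN
      map_add' := φ.gnsOperator_add hN
      map_smul' := φ.gnsOperator_smul hN }
  symm := φ.gnsSymm
  rep_id a := by
    induction a using Completion.induction_on with
    | hp => exact isClosed_eq (by fun_prop) (by fun_prop)
    | ih a => exact (φ.gnsOperator_coe hN _ a).trans (congrArg _ (PreGNS.postcomp_id a))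
  rep_comp S T a := by
    change φ.gnsOperator hN (S ≫ T) a = φ.gnsOperator hN T (φ.gnsOperator hN S a)
    induction a using Completion.induction_on with
    | hp => exact isClosed_eq (by fun_prop) (by fun_prop)
    | ih a => simp only [gnsOperator_coe, PreGNS.postcomp_comp]
  inner_rep T a b := by
    change inner ℂ (φ.gnsOperator hN T a) b = inner ℂ a (φ.gnsOperator hN (α.dag T) b)
    induction a, b using Completion.induction_on₂ with
    | hp => exact isClosed_eq (by fun_prop) (by fun_prop)
    | ih a b => simp only [gnsOperator_coe, Completion.inner_coe, PreGNS.inner_postcomp]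
  symm_symm a := by
    induction a using Completion.induction_on with
    | hp => exact isClosed_eq (by fun_prop) (by fun_prop)
    | ih a => simp only [gnsSymm_coe, PreGNS.involutive_symm a]
  isSymmetric_symm Y a b := by
    change inner ℂ (φ.gnsSymm Y a) b = inner ℂ a (φ.gnsSymm Y b)
    induction a, b using Completion.induction_on₂ with
    | hp => exact isClosed_eq (by fun_prop) (by fun_prop)
    | ih a b =>
      simp only [gnsSymm_coe, Completion.inner_coe]
      exact PreGNS.isSymmetric_symm a b
  rep_map T a := by
    change φ.gnsOperator hN (α.map T) a = φ.gnsSymm _ (φ.gnsOperator hN T (φ.gnsSymm _ a))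
    induction a using Completion.induction_on with
    | hp => exact isClosed_eq (by fun_prop) (by fun_prop)
    | ih a => simp only [gnsOperator_coe, gnsSymm_coe, PreGNS.postcomp_map]
  norm_rep_le := φ.norm_gnsOperator_le hN

/-- A morphism as a vector of the GNS representation. -/
def gnsVector {Y : C} (a : X ⟶ Y) : (φ.gns hN).space Y :=
  ((PreGNS.toHom φ Y).symm a : Completion (φ.PreGNS Y))

theorem gns_rep_gnsVector {Y Z : C} (a : X ⟶ Y) (T : Y ⟶ Z) :
    (φ.gns hN).rep T (φ.gnsVector hN a) = φ.gnsVector hN (a ≫ T) :=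
  φ.gnsOperator_coe hN T _

theorem norm_gnsVector_sq {Y : C} (a : X ⟶ Y) :
    ‖φ.gnsVector hN a‖ ^ 2 = (φ.toLin (a ≫ α.dag a)).re :=
  (congrArg (· ^ 2) (Completion.norm_coe _)).trans (PreGNS.norm_sq_eq _)

end InvariantState

end Involution

/-! ### The universal representation -/

theorem norm_le_norm_mapCLM {ι 𝕜 : Type*} [NontriviallyNormedField 𝕜] {E F : ι → Type*}
    [∀ i, NormedAddCommGroup (E i)] [∀ i, NormedSpace 𝕜 (E i)] [∀ i, NormedAddCommGroup (F i)]
    [∀ i, NormedSpace 𝕜 (F i)] {p : ℝ≥0∞} [Fact (1 ≤ p)] (T : ∀ i, E i →L[𝕜] F i) {K : ℝ}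
    (hK : 0 ≤ K) (hTK : ∀ i, ‖T i‖ ≤ K) (i : ι) : ‖T i‖ ≤ ‖lp.mapCLM p T hK hTK‖ := by
  classical
  have hp : 0 < p := zero_lt_one.trans_le Fact.out
  refine ContinuousLinearMap.opNorm_le_bound _ (norm_nonneg _) fun a => ?_
  calc ‖T i a‖ = ‖lp.mapCLM p T hK hTK (lp.single p i a) i‖ := by
        rw [lp.mapCLM_apply_coe, lp.single_apply_self]
    _ ≤ ‖lp.mapCLM p T hK hTK (lp.single p i a)‖ := lp.norm_apply_le_norm hp.ne' _ i
    _ ≤ ‖lp.mapCLM p T hK hTK‖ * ‖lp.single p i a‖ := ContinuousLinearMap.le_opNorm _ _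
    _ = ‖lp.mapCLM p T hK hTK‖ * ‖a‖ := by rw [lp.norm_single hp]

namespace Involution

variable {C : Type u} [Category.{v} C] [Preadditive C] [Linear ℂ C] [StarCategory C]
  {α : Involution C} {N : ∀ X Y : C, Seminorm ℂ (X ⟶ Y)}

namespace CovariantRep

theorem norm_symm_le (R : α.CovariantRep N) (A : C) : ‖R.symm A‖ ≤ 1 :=
  ContinuousLinearMap.opNorm_le_bound _ zero_le_one fun a =>
    (norm_map_of_involutive_of_isSymmetric R.symm_symm (R.isSymmetric_symm A) a).le.trans_eq
      (one_mul _).symm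

section DirectSum

variable {ι : Type*} (R : ι → α.CovariantRep N)

/-- The Hilbert space direct sum of a family of representations. -/
def directSum : α.CovariantRep N where
  space A := lp (fun i => (R i).space A) 2
  rep {A B} :=
    { toFun := fun T => lp.mapCLM 2 (fun i => (R i).rep T) (apply_nonneg (N A B) T)
        fun i => (R i).norm_rep_le T
      map_add' := fun S T => by
        ext a i
        exact DFunLike.congr_fun (map_add (R i).rep S T) (a i)
      map_smul' := fun c T => by
        ext a i
        exact DFunLike.congr_fun (map_smul (R i).rep c T) (a i) }
  symm A := lp.mapCLM 2 (fun i => (R i).symm A) zero_le_one fun i => (R i).norm_symm_le A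
  rep_id a := by
    ext i
    exact (R i).rep_id (a i)
  rep_comp S T a := by
    ext i
    exact (R i).rep_comp S T (a i)
  inner_rep T a b := by
    rw [lp.inner_eq_tsum, lp.inner_eq_tsum]
    exact tsum_congr fun i => (R i).inner_rep T (a i) (b i)
  symm_symm a := by
    ext i
    exact (R i).symm_symm (a i)
  isSymmetric_symm A a b := by
    rw [lp.inner_eq_tsum, lp.inner_eq_tsum]
    exact tsum_congr fun i => (R i).isSymmetric_symm A (a i) (b i)
  rep_map T a := by
    ext i
    exact (R i).rep_map T (a i)
  norm_rep_le {A B} T :=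
    lp.norm_mapCLM_le 2 _ (apply_nonneg (N A B) T) fun i => (R i).norm_rep_le T

theorem norm_rep_le_norm_directSum_rep {A B : C} (T : A ⟶ B) (i : ι) :
    ‖(R i).rep T‖ ≤ ‖(directSum R).rep T‖ :=
  norm_le_norm_mapCLM (fun i => (R i).rep T) (apply_nonneg (N A B) T)
    (fun i => (R i).norm_rep_le T) i

end DirectSum

end CovariantRep

variable (hN : α.IsCStarNorm N)

include hN

theorem InvariantState.re_comp_dag_le {X Y : C} (φ : α.InvariantState N X) (x : X ⟶ Y) :
    (φ.toLin (x ≫ α.dag x)).re ≤ ‖(φ.gns hN).rep x‖ ^ 2 := by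
  have hone : ‖φ.gnsVector hN (𝟙 X)‖ ^ 2 = 1 := by
    rw [norm_gnsVector_sq, dag_id, Category.comp_id, φ.map_one, Complex.one_re]
  calc (φ.toLin (x ≫ α.dag x)).re = ‖(φ.gns hN).rep x (φ.gnsVector hN (𝟙 X))‖ ^ 2 := by
        rw [gns_rep_gnsVector, Category.id_comp, norm_gnsVector_sq]
    _ ≤ (‖(φ.gns hN).rep x‖ * ‖φ.gnsVector hN (𝟙 X)‖) ^ 2 := by
        gcongr
        exact ContinuousLinearMap.le_opNorm _ _
    _ = ‖(φ.gns hN).rep x‖ ^ 2 := by rw [mul_pow, hone, mul_one]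

omit hN in
/-- The direct sum of the GNS representations of all the invariant states of all the objects. -/
def universalRep (hN : α.IsCStarNorm N) : CovariantRep.{u, v, max u v} α N :=
  .directSum fun φ : Σ X, α.InvariantState N X => φ.2.gns hN

theorem le_norm_universalRep {X Y : C} (x : X ⟶ Y) : N X Y x ≤ 2 * ‖(universalRep hN).rep x‖ := by
  obtain rfl | hx := eq_or_ne x 0
  · rw [map_zero]
    positivity
  obtain ⟨φ, hφ⟩ := hN.exists_invariantState hx
  have hle : ‖(φ.gns hN).rep x‖ ≤ ‖(universalRep hN).rep x‖ :=
    CovariantRep.norm_rep_le_norm_directSum_rep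
      (fun φ : Σ X, α.InvariantState N X => φ.2.gns hN) x ⟨X, φ⟩
  refine le_of_sq_le_sq ?_ (by positivity)
  calc N X Y x ^ 2 ≤ 2 * (φ.toLin (x ≫ α.dag x)).re := hφ
    _ ≤ 2 * ‖(universalRep hN).rep x‖ ^ 2 := by
        gcongr
        exact (φ.re_comp_dag_le hN x).trans (by gcongr)
    _ ≤ (2 * ‖(universalRep hN).rep x‖) ^ 2 := by nlinarith [sq_nonneg ‖(universalRep hN).rep x‖]

end Involution

/-! ### Krein spaces from self-adjoint unitaries -/

theorem isCompl_eigenspace_of_involutive {k V : Type*} [Field k] [CharZero k] [AddCommGroup V]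
    [Module k V] {U : Module.End k V} (hU : Function.Involutive U) :
    IsCompl (U.eigenspace 1) (U.eigenspace (-1)) := by
  have hne : (1 : k) ≠ -1 := by norm_num [eq_neg_iff_add_eq_zero]
  refine ⟨U.disjoint_genEigenspace hne 1 1, codisjoint_iff.2 (eq_top_iff.2 fun x _ => ?_)⟩
  refine Submodule.mem_sup.2 ⟨(1 / 2 : k) • (x + U x), ?_, (1 / 2 : k) • (x - U x), ?_, by module⟩
  · rw [Module.End.mem_eigenspace_iff, map_smul, map_add, hU, add_comm, one_smul]
  · rw [Module.End.mem_eigenspace_iff, map_smul, map_sub, hU]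
    module

theorem map_add_of_mem_eigenspace {k V : Type*} [CommRing k] [AddCommGroup V] [Module k V]
    {U : Module.End k V} {x y : V} (hx : x ∈ U.eigenspace 1) (hy : y ∈ U.eigenspace (-1)) :
    U (x + y) = x - y := by
  rw [map_add, Module.End.mem_eigenspace_iff.1 hx, Module.End.mem_eigenspace_iff.1 hy, one_smul,
    neg_one_smul, sub_eq_add_neg]

theorem isClosed_eigenspace {k V : Type*} [Field k] [AddCommGroup V] [Module k V]
    [TopologicalSpace V] [T2Space V] [ContinuousConstSMul k V] (U : V →L[k] V) (μ : k) :
    IsClosed (Module.End.eigenspace (U : V →ₗ[k] V) μ : Set V) := by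
  have heq : (Module.End.eigenspace (U : V →ₗ[k] V) μ : Set V) = {x | U x = μ • x} :=
    Set.ext fun x => Module.End.mem_eigenspace_iff
  rw [heq]
  exact isClosed_eq U.continuous (continuous_const_smul μ)

theorem isHilbertOn_of_re_eq_norm_sq {V : Type*} [NormedAddCommGroup V] [NormedSpace ℂ V]
    [CompleteSpace V] {B : V →ₗ⋆[ℂ] V →ₗ[ℂ] ℂ} {S : Submodule ℂ V} (hS : IsClosed (S : Set V))
    (hB : ∀ x ∈ S, (B x x).re = ‖x‖ ^ 2) : IsHilbertOn B S where
  pos x hx h0 := by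
    rw [hB x hx]
    positivity
  complete s hs hc := by
    have hcauchy : CauchySeq s := Metric.cauchySeq_iff.2 fun ε hε => by
      obtain ⟨n₀, hn₀⟩ := hc (ε ^ 2) (by positivity)
      refine ⟨n₀, fun m hm n hn => ?_⟩
      rw [dist_eq_norm, ← sq_lt_sq₀ (norm_nonneg _) hε.le, ← hB _ (S.sub_mem (hs m) (hs n))]
      exact hn₀ m hm n hn
    obtain ⟨x, hx⟩ := cauchySeq_tendsto_of_complete hcauchy
    have hxS : x ∈ S := hS.mem_of_tendsto hx (.of_forall hs)
    have hlim := (tendsto_iff_norm_sub_tendsto_zero.1 hx).pow 2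
    rw [zero_pow two_ne_zero] at hlim
    exact ⟨x, hxS, hlim.congr fun n => (hB _ (S.sub_mem (hs n) hxS)).symm⟩

namespace KreinSpace

variable {H : Type w} [NormedAddCommGroup H] [InnerProductSpace ℂ H]

/-- The sesquilinear form `⟨x, U y⟩` of an operator `U` on a Hilbert space. -/
def hilbertForm (U : H →L[ℂ] H) : H →ₗ⋆[ℂ] H →ₗ[ℂ] ℂ :=
  (innerₛₗ ℂ).compl₂ (U : H →ₗ[ℂ] H)

theorem hilbertForm_apply (U : H →L[ℂ] H) (x y : H) : hilbertForm U x y = inner ℂ x (U y) := rfl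

variable [CompleteSpace H] {U : H →L[ℂ] H} (hU : Function.Involutive U)
  (hs : (U : H →ₗ[ℂ] H).IsSymmetric)

include hU hs in
theorem isFundamentalDecomposition_hilbertForm :
    IsFundamentalDecomposition (hilbertForm U) (Module.End.eigenspace (U : H →ₗ[ℂ] H) 1)
      (Module.End.eigenspace (U : H →ₗ[ℂ] H) (-1)) where
  isCompl := isCompl_eigenspace_of_involutive hU
  orthogonal x hx y hy := by
    have hUy : U y = (-1 : ℂ) • y := Module.End.mem_eigenspace_iff.1 hy
    have horth : inner ℂ x y = 0 :=
      hs.orthogonalFamily_eigenspaces (by norm_num : (1 : ℂ) ≠ -1) ⟨x, hx⟩ ⟨y, hy⟩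
    rw [hilbertForm_apply, hUy, inner_smul_right, horth, mul_zero]
  hilbert_pos := isHilbertOn_of_re_eq_norm_sq (isClosed_eigenspace U 1) fun x hx => by
    have hUx : U x = (1 : ℂ) • x := Module.End.mem_eigenspace_iff.1 hx
    rw [hilbertForm_apply, hUx, one_smul]
    exact (norm_sq_eq_re_inner (𝕜 := ℂ) x).symm
  hilbert_neg := isHilbertOn_of_re_eq_norm_sq (isClosed_eigenspace U (-1)) fun x hx => by
    have hUx : U x = (-1 : ℂ) • x := Module.End.mem_eigenspace_iff.1 hx
    rw [LinearMap.neg_apply, LinearMap.neg_apply, hilbertForm_apply, hUx, neg_one_smul,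
      inner_neg_right, neg_neg]
    exact (norm_sq_eq_re_inner (𝕜 := ℂ) x).symm

/-- The Krein space of a Hilbert space with a self-adjoint unitary `U`: its form is
`⟨x, U y⟩`. -/
def ofHilbert : KreinSpace.{w} where
  carrier := H
  form := hilbertForm U
  form_symm x y := by
    rw [hilbertForm_apply, hilbertForm_apply, inner_conj_symm]
    exact hs y x
  exists_decomposition := ⟨_, _, isFundamentalDecomposition_hilbertForm hU hs⟩

/-- The self-adjoint unitary `U` as a fundamental symmetry. -/
def ofHilbertSymm : (ofHilbert hU hs).FundamentalSymmetry where
  toLin := U.toLinearMap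
  exists_decomposition :=
    have h := isFundamentalDecomposition_hilbertForm hU hs
    ⟨_, _, h, fun _ hx _ hy => map_add_of_mem_eigenspace hx hy⟩

theorem norm_toAssoc_ofHilbertSymm (x : H) : ‖(ofHilbertSymm hU hs).toAssoc x‖ = ‖x‖ := by
  rw [← sq_eq_sq₀ (norm_nonneg _) (norm_nonneg _)]
  refine (FundamentalSymmetry.norm_sq_toAssoc _ _).trans ?_
  change (inner ℂ x (U (U x))).re = ‖x‖ ^ 2
  rw [hU]
  exact (norm_sq_eq_re_inner (𝕜 := ℂ) x).symm

/-- The Hilbert space associated to the fundamental symmetry `U` is the one started with. -/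
def ofHilbertAssoc : (ofHilbertSymm hU hs).Assoc ≃ₗᵢ[ℂ] H where
  toLinearEquiv := (ofHilbertSymm hU hs).toAssoc.symm.trans (LinearEquiv.refl ℂ H)
  norm_map' x := by
    obtain ⟨x, rfl⟩ := (ofHilbertSymm hU hs).toAssoc.surjective x
    exact (norm_toAssoc_ofHilbertSymm hU hs x).symm

/-- The identity map, from the Krein space with its strong topology to the Hilbert space. -/
def ofHilbertEquiv : ofHilbert hU hs ≃L[ℂ] H :=
  (ofHilbertSymm hU hs).toAssocL.trans (ofHilbertAssoc hU hs).toContinuousLinearEquiv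

end KreinSpace

/-! ### Representations on Krein spaces -/

namespace Involution

theorem IsFundamentalSymmetry.of_fullyFaithful {C D : Type*} [Category* C] [Preadditive C]
    [Linear ℂ C] [StarCategory C] [Category* D] [Preadditive D] [Linear ℂ D] [StarCategory D]
    {α : Involution C} {β : Involution D} (hα : α.IsFundamentalSymmetry) {G : D ⥤ C}
    (hG : IsStarFunctor G) (hfull : G.FullyFaithful)
    (hmap : ∀ {X Y : D} (x : X ⟶ Y), G.map (β.map x) = α.map (G.map x)) :
    β.IsFundamentalSymmetry := by
  obtain ⟨N, hN⟩ := hα.exists_isCStarNorm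
  let e (X Y : D) : (X ⟶ Y) ≃ₗ[ℂ] (G.obj X ⟶ G.obj Y) :=
    .ofBijective ⟨⟨G.map, hG.map_add⟩, hG.map_smul⟩ (hfull.map_bijective X Y)
  have map_comp_dag {X Y : D} (x : X ⟶ Y) :
      G.map (x ≫ β.dag x) = G.map x ≫ α.dag (G.map x) := by
    rw [G.map_comp]
    exact congrArg (G.map x ≫ ·) ((hmap _).trans (congrArg α.map (hG.map_star x)))
  refine ⟨⟨fun X Y => (N (G.obj X) (G.obj Y)).comp (e X Y : (X ⟶ Y) →ₗ[ℂ] _),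
    fun X Y => (hN.banach _ _).comp_linearEquiv (e X Y), fun {X Y} x => ?_⟩,
    fun {X Y} x => ⟨β.dag_comp_dag_self x, ?_⟩⟩
  · exact (congrArg (N _ _) (map_comp_dag x)).trans (hN.cstar (G.map x))
  · let endEquiv : End X ≃ₐ[ℂ] End (G.obj X) :=
      .ofLinearEquiv (e X X) (G.map_id X) fun x y => G.map_comp y x
    have hpos := (hN.pos (G.map x)).2
    rw [← map_comp_dag] at hpos
    rw [← AlgEquiv.spectrum_eq endEquiv]
    exact hpos

namespace CovariantRep

variable {C : Type u} [Category.{v} C] [Preadditive C] [Linear ℂ C] [StarCategory C]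
  {α : Involution C} {N : ∀ X Y : C, Seminorm ℂ (X ⟶ Y)} (R : CovariantRep.{u, v, w} α N)

/-- The Hilbert space of `R` at `A`, regarded as a Krein space with the form `⟨x, R.symm A y⟩`. -/
def kreinSpace (A : C) : KreinSpace.{w} :=
  .ofHilbert (U := R.symm A) R.symm_symm (R.isSymmetric_symm A)

/-- The operator `R.symm A` as a fundamental symmetry of `R.kreinSpace A`. -/
def kreinSymm (A : C) : (R.kreinSpace A).FundamentalSymmetry :=
  KreinSpace.ofHilbertSymm R.symm_symm (R.isSymmetric_symm A)

/-- The identity map, from the Krein space to the Hilbert space. -/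
def kreinEquiv (A : C) : R.kreinSpace A ≃L[ℂ] R.space A :=
  KreinSpace.ofHilbertEquiv R.symm_symm (R.isSymmetric_symm A)

theorem form_kreinSpace {A : C} (x y : R.kreinSpace A) : (R.kreinSpace A).form x y =
    inner ℂ (R.kreinEquiv A x) (R.symm A (R.kreinEquiv A y)) := rfl

theorem kreinEquiv_kreinSymm {A : C} (x : R.kreinSpace A) :
    R.kreinEquiv A (R.kreinSymm A x) = R.symm A (R.kreinEquiv A x) := rfl

/-- The operators of `R`, between the Krein spaces. -/
def kreinRep {A B : C} : (A ⟶ B) →ₗ[ℂ] (R.kreinSpace A →L[ℂ] R.kreinSpace B) :=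
  ((R.kreinEquiv A).symm.arrowCongr (R.kreinEquiv B).symm).toLinearEquiv.toLinearMap ∘ₗ R.rep

theorem kreinEquiv_kreinRep {A B : C} (T : A ⟶ B) (x : R.kreinSpace A) :
    R.kreinEquiv B (R.kreinRep T x) = R.rep T (R.kreinEquiv A x) :=
  (R.kreinEquiv B).apply_symm_apply _

theorem kreinRep_id (A : C) : R.kreinRep (𝟙 A) = ContinuousLinearMap.id ℂ _ := by
  ext x
  apply (R.kreinEquiv A).injective
  rw [kreinEquiv_kreinRep, rep_id, ContinuousLinearMap.id_apply]

theorem kreinRep_comp {A B D : C} (S : A ⟶ B) (T : B ⟶ D) :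
    R.kreinRep (S ≫ T) = R.kreinRep T ∘L R.kreinRep S := by
  ext x
  apply (R.kreinEquiv D).injective
  simp only [kreinEquiv_kreinRep, rep_comp, ContinuousLinearMap.comp_apply]

theorem kreinRep_map {A B : C} (T : A ⟶ B) : R.kreinRep (α.map T) =
    (R.kreinSymm B).toCLM ∘L R.kreinRep T ∘L (R.kreinSymm A).toCLM := by
  ext x
  apply (R.kreinEquiv B).injective
  rw [kreinEquiv_kreinRep, rep_map, ← kreinEquiv_kreinSymm, ← kreinEquiv_kreinRep]
  rfl

theorem kreinRep_star {A B : C} (T : A ⟶ B) :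
    R.kreinRep (star T) = KreinSpace.adjoint (R.kreinRep T) := by
  refine (KreinSpace.eq_adjoint fun x y => ?_).symm
  have rep_star (b : R.space B) : R.rep (α.dag T) (R.symm B b) = R.symm A (R.rep (star T) b) :=
    (R.rep_map (star T) _).trans (by rw [R.symm_symm])
  simp only [form_kreinSpace, kreinEquiv_kreinRep, inner_rep, rep_star]

/-- `R` as a functor to the category of the Krein spaces `R.kreinSpace A`. -/
def functor : C ⥤ BK R.kreinSpace where
  obj A := ⟨A⟩
  map T := R.kreinRep T
  map_id := R.kreinRep_id
  map_comp := R.kreinRep_comp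

theorem isStarFunctor_functor : IsStarFunctor R.functor where
  map_add x y := map_add R.kreinRep x y
  map_smul c x := map_smul R.kreinRep c x
  map_star := R.kreinRep_star

/-- The range of `R`, as a star-subcategory of the category of the Krein spaces
`R.kreinSpace A`. -/
def image : StarSubcategory (BK R.kreinSpace) where
  hom X Y := LinearMap.range (R.kreinRep (A := X.idx) (B := Y.idx))
  id_mem X := ⟨𝟙 X.idx, R.kreinRep_id X.idx⟩
  comp_mem := by
    rintro X Y Z _ _ ⟨S, rfl⟩ ⟨T, rfl⟩
    exact ⟨S ≫ T, R.kreinRep_comp S T⟩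
  star_mem := by
    rintro X Y _ ⟨T, rfl⟩
    exact ⟨star T, R.kreinRep_star T⟩

/-- `R` as a functor onto its image. -/
def toImage : C ⥤ R.image.Obj where
  obj A := ⟨⟨A⟩⟩
  map T := ⟨R.kreinRep T, T, rfl⟩
  map_id A := Subtype.ext (R.kreinRep_id A)
  map_comp S T := Subtype.ext (R.kreinRep_comp S T)

theorem isStarFunctor_toImage : IsStarFunctor R.toImage where
  map_add x y := Subtype.ext (map_add R.kreinRep x y)
  map_smul c x := Subtype.ext (map_smul R.kreinRep c x)
  map_star x := Subtype.ext (R.kreinRep_star x)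

/-- The restriction to the image of `R` of the involution `T ↦ J T J`. -/
def imageInvolution : Involution R.image.Obj where
  map {X Y} :=
    { toFun := fun T => ⟨(BK.conj R.kreinSymm).map T.1, by
        obtain ⟨_, T, rfl⟩ := T
        exact ⟨α.map T, R.kreinRep_map T⟩⟩
      map_add' := fun S T => Subtype.ext (map_add (BK.conj R.kreinSymm).map S.1 T.1)
      map_smul' := fun c T => Subtype.ext (map_smul (BK.conj R.kreinSymm).map c T.1) }
  map_id X := Subtype.ext ((BK.conj R.kreinSymm).map_id X.obj)
  map_comp S T := Subtype.ext ((BK.conj R.kreinSymm).map_comp S.1 T.1)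
  map_star T := Subtype.ext ((BK.conj R.kreinSymm).map_star T.1)
  map_map T := Subtype.ext ((BK.conj R.kreinSymm).map_map T.1)

theorem toImage_map_map {A B : C} (T : A ⟶ B) :
    R.toImage.map (α.map T) = R.imageInvolution.map (R.toImage.map T) :=
  Subtype.ext (R.kreinRep_map T)

section BoundedBelow

variable {A B : C} {k : ℝ≥0}

theorem isClosed_range_kreinRep (hbanach : IsBanachNorm (N A B))
    (hk : ∀ T : A ⟶ B, N A B T ≤ k * ‖R.rep T‖) :
    IsClosed (Set.range (R.kreinRep (A := A) (B := B))) := by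
  have hrange : IsClosed (Set.range (R.rep (A := A) (B := B))) :=
    hbanach.isClosed_range R.rep (c := 1) (fun T => by simpa using R.norm_rep_le T) hk
  have hmap := ((R.kreinEquiv A).symm.arrowCongr (R.kreinEquiv B).symm).toHomeomorph.isClosedMap
    _ hrange
  rwa [← Set.range_comp] at hmap

theorem kreinRep_injective (hbanach : IsBanachNorm (N A B))
    (hk : ∀ T : A ⟶ B, N A B T ≤ k * ‖R.rep T‖) :
    Function.Injective (R.kreinRep (A := A) (B := B)) := by
  refine ((R.kreinEquiv A).symm.arrowCongr (R.kreinEquiv B).symm).injective.comp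
    ((injective_iff_map_eq_zero R.rep).2 fun T hT => hbanach.eq_zero T ?_)
  refine le_antisymm ((hk T).trans_eq ?_) (apply_nonneg _ _)
  rw [hT, norm_zero, mul_zero]

end BoundedBelow

section Injective

variable (hR : ∀ A B : C, Function.Injective (R.kreinRep (A := A) (B := B)))

/-- The isomorphism of a space of morphisms onto its image. -/
def homEquivImage (X Y : R.image.Obj) : (X.obj.idx ⟶ Y.obj.idx) ≃ₗ[ℂ] (X ⟶ Y) :=
  LinearEquiv.ofInjective R.kreinRep (hR X.obj.idx Y.obj.idx)

include hR in
theorem isStarIso_toImage : IsStarIso R.toImage where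
  __ := R.isStarFunctor_toImage
  bijective_obj := ⟨fun _ _ h => congrArg (fun X => X.obj.idx) h, fun X => ⟨X.obj.idx, rfl⟩⟩
  bijective_map _ _ := (R.homEquivImage hR ⟨⟨_⟩⟩ ⟨⟨_⟩⟩).bijective

/-- The inverse of `R.toImage`. -/
def fromImage : R.image.Obj ⥤ C where
  obj X := X.obj.idx
  map {X Y} := (R.homEquivImage hR X Y).symm
  map_id X := (LinearEquiv.symm_apply_eq _).2 (R.toImage.map_id X.obj.idx).symm
  map_comp {X Y Z} S T := by
    obtain ⟨x, rfl⟩ := (R.homEquivImage hR X Y).surjective S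
    obtain ⟨y, rfl⟩ := (R.homEquivImage hR Y Z).surjective T
    rw [LinearEquiv.symm_apply_apply, LinearEquiv.symm_apply_apply, LinearEquiv.symm_apply_eq]
    exact (R.toImage.map_comp x y).symm

theorem isStarFunctor_fromImage : IsStarFunctor (R.fromImage hR) where
  map_add := map_add (R.homEquivImage hR _ _).symm
  map_smul := map_smul (R.homEquivImage hR _ _).symm
  map_star {X Y} T := by
    obtain ⟨x, rfl⟩ := (R.homEquivImage hR X Y).surjective T
    refine (LinearEquiv.symm_apply_eq _).2 ((R.isStarFunctor_toImage.map_star x).symm.trans ?_)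
    exact congrArg (fun y => R.toImage.map (star y))
      ((R.homEquivImage hR X Y).symm_apply_apply x).symm

include hR in
theorem isFundamentalSymmetry_imageInvolution (hα : α.IsFundamentalSymmetry) :
    R.imageInvolution.IsFundamentalSymmetry := by
  refine hα.of_fullyFaithful (R.isStarFunctor_fromImage hR)
    { preimage := R.homEquivImage hR _ _
      map_preimage := (R.homEquivImage hR _ _).symm_apply_apply
      preimage_map := (R.homEquivImage hR _ _).apply_symm_apply } fun {X Y} T => ?_
  obtain ⟨x, rfl⟩ := (R.homEquivImage hR X Y).surjective T
  refine (LinearEquiv.symm_apply_eq _).2 ((R.toImage_map_map x).symm.trans ?_)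
  exact congrArg (fun y => R.toImage.map (α.map y))
    ((R.homEquivImage hR X Y).symm_apply_apply x).symm

end Injective

end CovariantRep

end Involution

end Krein

end

open Krein in
theorem mainTheorem2 {C : Type u} [Category.{v} C] [Preadditive C] [Linear ℂ C]
    [StarCategory C] (α : Involution C) (hα : α.IsFundamentalSymmetry) :
    ∃ (K : C → KreinSpace.{max u v}) (J : ∀ A, (K A).FundamentalSymmetry) (π : C ⥤ BK K),
      IsStarFunctor π ∧ (∀ A, π.obj A = ⟨A⟩) ∧ π.Faithful ∧
      (∀ {A B : C} (x : A ⟶ B), π.map (α.map x) = (BK.conj J).map (π.map x)) ∧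
      ∃ S : StarSubcategory (BK K), BK.IsClosedSubcategory S ∧
        IsKreinCStarCategory S.Obj ∧
        (∃ β : Involution S.Obj, β.IsFundamentalSymmetry ∧
          ∀ {X Y : S.Obj} (T : X ⟶ Y), (β.map T).1 = (BK.conj J).map T.1) ∧
        ∃ F : C ⥤ S.Obj, IsStarIso F ∧ F ⋙ S.incl = π := by
  obtain ⟨N, hN⟩ := hα.exists_isCStarNorm
  obtain ⟨R, hR⟩ : ∃ R : Involution.CovariantRep.{u, v, max u v} α N,
      ∀ {A B : C} (x : A ⟶ B), N A B x ≤ (2 : NNReal) * ‖R.rep x‖ :=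
    ⟨Involution.universalRep hN, Involution.le_norm_universalRep hN⟩
  have hinj A B := R.kreinRep_injective (hN.banach A B) hR
  have hclosed A B := R.isClosed_range_kreinRep (hN.banach A B) hR
  have hβ := R.isFundamentalSymmetry_imageInvolution hinj hα
  exact ⟨R.kreinSpace, R.kreinSymm, R.functor, R.isStarFunctor_functor, fun _ => rfl,
    ⟨fun h => hinj _ _ h⟩, R.kreinRep_map, R.image, fun X Y => hclosed X.idx Y.idx, ⟨_, hβ⟩,
    ⟨_, hβ, fun _ => rfl⟩, R.toImage, R.isStarIso_toImage hinj, rfl⟩
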